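/- There is an absolute constant $N$ such that the following holds. Let $h\ge 1$, let $0<\varepsilon<\frac{1}{2h+2h^2}$, and let $i\ge 2$ be an integer. Call a square large if its side length is at least $\varepsilon^{6^{i-1}}$, and small if its side length is positive and at most $\varepsilon^{6^{i}}$. All squares are placed axis-parallel, and different squares have disjoint interiors. Suppose that at most $4$ large squares are packed into the bin $[0,1]\times[0,h]$ by corner packing, that is, one after the other, each within the space of the bin that is still uncovered and with one of its corners at a vertex of the current uncovered rectilinear polygons at which the interior angle is $90^\circ$. Suppose also that the total area of these large squares is at least $h-\varepsilon^{4\cdot 6^{i-1}-2}$. Then the uncovered rectilinear polygons (the closure $P$ of the uncovered part of the interior of the bin) can be dissected into at most $N$ rectangular blocks, that is, $P$ is the union of at most $N$ non-degenerate closed axis-parallel rectangles with pairwise disjoint interiors, such that for every finite list $L$ of small squares with nonnegative profits \[ OPT_b(L)\ \ge\ (1-\varepsilon)\,OPT_p(L). \] Here $OPT_p(L)$ is the maximum total profit of a sublist of $L$ that can be packed into $P$, and $OPT_b(L)$ is the maximum total profit of a sublist of $L$ that can be packed into the blocks, each square lying in a single block. -/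

import Mathlib

open Set Filter Topology

noncomputable section

/-- An axis-parallel square placed in the plane: lower left corner `(x, y)` and side length. -/
structure PlacedSquare where
  x : ℝ
  y : ℝ
  side : ℝ

namespace PlacedSquare

/-- The points covered by the square. -/
def closed (q : PlacedSquare) : Set (ℝ × ℝ) :=
  Icc q.x (q.x + q.side) ×ˢ Icc q.y (q.y + q.side)

/-- The interior of the square. -/
def inner (q : PlacedSquare) : Set (ℝ × ℝ) :=
  Ioo q.x (q.x + q.side) ×ˢ Ioo q.y (q.y + q.side)

/-- The four corners of the square. -/
def corners (q : PlacedSquare) : Set (ℝ × ℝ) :=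
  {q.x, q.x + q.side} ×ˢ {q.y, q.y + q.side}

def area (q : PlacedSquare) : ℝ := q.side ^ 2

end PlacedSquare

/-- The interior of the space of the bin `[0, 1] × [0, h]` that the squares in `Q` leave
uncovered. -/
def freeSpace (h : ℝ) (Q : List PlacedSquare) : Set (ℝ × ℝ) :=
  (Ioo 0 1 ×ˢ Ioo 0 h) \ ⋃ q ∈ Q, q.closed

/-- The uncovered rectilinear polygon(s), as a closed region. -/
def polygons (h : ℝ) (Q : List PlacedSquare) : Set (ℝ × ℝ) :=
  closure (freeSpace h Q)

/-- The open quadrant with apex `v` in the direction of the signs `σ` and `τ`. -/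
def quadrant (v : ℝ × ℝ) (σ τ : ℝ) : Set (ℝ × ℝ) :=
  {p | 0 < σ * (p.1 - v.1) ∧ 0 < τ * (p.2 - v.2)}

/-- `v` is a vertex of the rectilinear polygons with interior `U` at which an interior angle is
`90` degrees: close to `v`, one of the four quadrants at `v` belongs to `U`, and the two quadrants
next to it do not meet `U`. (The opposite quadrant may belong to `U`: two polygons may touch
at `v`.) -/
def IsRightAngleVertex (U : Set (ℝ × ℝ)) (v : ℝ × ℝ) : Prop :=
  ∃ σ τ : ℝ, (σ = 1 ∨ σ = -1) ∧ (τ = 1 ∨ τ = -1) ∧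
    ∀ᶠ p in 𝓝 v, (p ∈ quadrant v σ τ → p ∈ U) ∧
      (p ∈ quadrant v (-σ) τ → p ∉ U) ∧ (p ∈ quadrant v σ (-τ) → p ∉ U)

/-- The squares of the list, whose head is the square that was packed last, are packed into the
bin `[0, 1] × [0, h]` by corner packing: each square is placed in the space that is uncovered
so far, with one of its corners at a vertex of the current rectilinear polygons at which the
interior angle is `90` degrees. -/
inductive IsCornerPacking (h : ℝ) : List PlacedSquare → Prop
  | nil : IsCornerPacking h []
  | cons {q : PlacedSquare} {Q : List PlacedSquare} (hQ : IsCornerPacking h Q)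
      (hpos : 0 < q.side) (hfree : q.inner ⊆ freeSpace h Q)
      (hcorner : ∃ v ∈ q.corners, IsRightAngleVertex (freeSpace h Q) v) :
      IsCornerPacking h (q :: Q)

/-- A rectangular block `[x, x + width] × [y, y + height]`. -/
structure Block where
  x : ℝ
  y : ℝ
  width : ℝ
  height : ℝ

namespace Block

def closed (b : Block) : Set (ℝ × ℝ) :=
  Icc b.x (b.x + b.width) ×ˢ Icc b.y (b.y + b.height)

def inner (b : Block) : Set (ℝ × ℝ) :=
  Ioo b.x (b.x + b.width) ×ˢ Ioo b.y (b.y + b.height)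

end Block

/-- The blocks `B 0, …, B (m - 1)` are a dissection of the region `P`: they are nondegenerate,
do not overlap, and their union is `P`. -/
def IsDissection {m : ℕ} (B : Fin m → Block) (P : Set (ℝ × ℝ)) : Prop :=
  (∀ k, 0 < (B k).width ∧ 0 < (B k).height) ∧
    Pairwise (fun k l => Disjoint (B k).inner (B l).inner) ∧
    ⋃ k, (B k).closed = P

/-- A square of the input list: its side length and its profit. -/
structure Item where
  side : ℝ
  profit : ℝ

/-- The items of `L` with index in `S` can be packed into the regions of the family `𝒳`: they can
be placed, axis-parallel and without overlapping, such that each lies in one of the regions. -/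
def CanPack {n : ℕ} (L : Fin n → Item) (S : Finset (Fin n)) (𝒳 : Set (Set (ℝ × ℝ))) : Prop :=
  ∃ pos : Fin n → ℝ × ℝ,
    (∀ j ∈ S, ∃ X ∈ 𝒳, (PlacedSquare.mk (pos j).1 (pos j).2 (L j).side).closed ⊆ X) ∧
    ∀ j ∈ S, ∀ l ∈ S, j ≠ l →
      Disjoint (PlacedSquare.mk (pos j).1 (pos j).2 (L j).side).inner
        (PlacedSquare.mk (pos l).1 (pos l).2 (L l).side).inner

/-- The total profits of the sublists of `L` that can be packed into the regions of `𝒳`. -/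
def packedProfits {n : ℕ} (L : Fin n → Item) (𝒳 : Set (Set (ℝ × ℝ))) : Set ℝ :=
  {p | ∃ S : Finset (Fin n), CanPack L S 𝒳 ∧ p = ∑ j ∈ S, (L j).profit}

/-- The optimal value of packing the list `L` into the regions of `𝒳`. -/
def opt {n : ℕ} (L : Fin n → Item) (𝒳 : Set (Set (ℝ × ℝ))) : ℝ :=
  sSup (packedProfits L 𝒳)

/-- The optimal value is attained. -/
theorem opt_isGreatest {n : ℕ} (L : Fin n → Item) (𝒳 : Set (Set (ℝ × ℝ))) :
    IsGreatest (packedProfits L 𝒳) (opt L 𝒳) := by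
  have hne : (packedProfits L 𝒳).Nonempty :=
    ⟨0, ∅, ⟨fun _ => 0, by simp, by simp⟩, by simp⟩
  have hfin : (packedProfits L 𝒳).Finite := by
    refine (Set.finite_range fun S : Finset (Fin n) => ∑ j ∈ S, (L j).profit).subset ?_
    rintro p ⟨S, -, rfl⟩
    exact ⟨S, rfl⟩
  exact ⟨hne.csSup_mem hfin, fun p hp => le_csSup hfin.bddAbove hp⟩

end

/-! Draw the full horizontal and vertical lines through the sides of the bin and of the at most four
large squares. With a threshold `M`, cut the uncovered region into maximal free runs in rows taller
than `M`, maximal free runs in columns wider than `M`, and the remaining free cells. If no free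
square has side exceeding `M`, a free cell never lies both in a tall row and in a wide column, so
these blocks do not overlap (`IsGridBlock.eq_of_overlap`). There are at most ten lines in each
direction, hence at most `10 ^ 4` blocks.

The threshold is the largest width of a free arm of length at least `D`, where `D` is a quarter of
the lower bound for the sides of the large squares. That this width also bounds every free square is
the geometric core, `TightPacking.squareBound`. A larger free square could not be extended by `D` in
any direction, so each direction is blocked by a different large square and the four squares form a
pinwheel. Corner packing makes every square touch something at a vertical and at a horizontal side;
this concentrates the slack beside each square in a single gap. Each of the four gaps is at most `M`
wide, while the widths sum to at least four times the side of the central square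
(`TightPacking.pinwheel`).

Given a packing of small squares in the region, a square that lies in no block crosses a grid edge
of length at most `M` (`GridRegion.inGridBlock_or_crosses`). Squares crossing one such edge have
total side at most `3 * M`, so all of them together have total side at most `600 * M` and can be
stacked in a strip of width `M` and height `600 * M`. The area hypothesis forces `M` to be tiny
compared with `ε * D`, so the widest arm contains many such strips. Averaging gives one that is
crossed by no grid line and meets squares of at most the fraction `ε` of the profit
(`exists_cheap_strip`). Those squares are discarded and the crossing squares take their place
(`GridRegion.canRepack`). -/

/-! ### Grids of free rectangles and their blocks -/

/-- `a` and `b` are consecutive elements of the finite set `X`. -/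
structure Consec (X : Finset ℝ) (a b : ℝ) : Prop where
  left_mem : a ∈ X
  right_mem : b ∈ X
  lt : a < b
  gap : ∀ x ∈ X, x ≤ a ∨ b ≤ x

/-- The half-open convention assigns a point on a grid line to the interval on its right, the one
entered by a rectangle whose left end is there. -/
theorem Consec.exists_of_mem {X : Finset ℝ} {x₁ x₂ u : ℝ} (h₁ : x₁ ∈ X) (h₂ : x₂ ∈ X)
    (h₁u : x₁ ≤ u) (hu₂ : u < x₂) : ∃ a b, Consec X a b ∧ a ≤ u ∧ u < b := by
  classical
  have hA : (X.filter (· ≤ u)).Nonempty := ⟨x₁, by simp [h₁, h₁u]⟩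
  have hB : (X.filter (u < ·)).Nonempty := ⟨x₂, by simp [h₂, hu₂]⟩
  have ha := Finset.max'_mem _ hA
  have hb := Finset.min'_mem _ hB
  simp only [Finset.mem_filter] at ha hb
  refine ⟨_, _, ⟨ha.1, hb.1, ha.2.trans_lt hb.2, fun x hx => ?_⟩, ha.2, hb.2⟩
  rcases le_or_gt x u with h | h
  · exact Or.inl (Finset.le_max' _ _ (by simp [hx, h]))
  · exact Or.inr (Finset.min'_le _ _ (by simp [hx, h]))

theorem Consec.eq_or_disjoint {X : Finset ℝ} {a b a' b' : ℝ} (h : Consec X a b)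
    (h' : Consec X a' b') (h₁ : a < b') (h₂ : a' < b) : a = a' ∧ b = b' := by
  have := h.gap a' h'.left_mem
  have := h.gap b' h'.right_mem
  have := h'.gap a h.left_mem
  have := h'.gap b h.right_mem
  have := h.lt
  have := h'.lt
  constructor <;> grind

/-- A family of rectangles `[x₁, x₂] × [y₁, y₂]` behaves like the rectangles of a rectilinear region
all of whose vertices lie on the lines `x ∈ X` and `y ∈ Y`. -/
structure GridRegion (F : ℝ → ℝ → ℝ → ℝ → Prop) (X Y : Finset ℝ) : Prop where
  mono : ∀ {x₁ x₂ y₁ y₂ x₁' x₂' y₁' y₂'}, F x₁ x₂ y₁ y₂ → x₁ ≤ x₁' → x₂' ≤ x₂ → y₁ ≤ y₁' →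
    y₂' ≤ y₂ → F x₁' x₂' y₁' y₂'
  merge_left : ∀ {x₁ x₂ x₁' x₂' y₁ y₂}, F x₁ x₂ y₁ y₂ → F x₁' x₂' y₁ y₂ → x₁ < x₂' → x₁' < x₂ →
    F (min x₁ x₁') (max x₂ x₂') y₁ y₂
  merge_right : ∀ {x₁ x₂ y₁ y₂ y₁' y₂'}, F x₁ x₂ y₁ y₂ → F x₁ x₂ y₁' y₂' → y₁ < y₂' → y₁' < y₂ →
    F x₁ x₂ (min y₁ y₁') (max y₂ y₂')
  hull_left : ∀ {x₁ x₂ y₁ y₂}, F x₁ x₂ y₁ y₂ → ∃ a ∈ X, ∃ b ∈ X, a ≤ x₁ ∧ x₂ ≤ b ∧ F a b y₁ y₂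
  hull_right : ∀ {x₁ x₂ y₁ y₂}, F x₁ x₂ y₁ y₂ → ∃ a ∈ Y, ∃ b ∈ Y, a ≤ y₁ ∧ y₂ ≤ b ∧ F x₁ x₂ a b

/-- Interchange of the two coordinate axes. -/
def swapAxes (F : ℝ → ℝ → ℝ → ℝ → Prop) : ℝ → ℝ → ℝ → ℝ → Prop :=
  fun x₁ x₂ y₁ y₂ => F y₁ y₂ x₁ x₂

/-- A maximal horizontal run of free cells in a row of height more than `M`. -/
structure IsRun (F : ℝ → ℝ → ℝ → ℝ → Prop) (X Y : Finset ℝ) (M x₁ x₂ y₁ y₂ : ℝ) : Prop where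
  row : Consec Y y₁ y₂
  tall : M < y₂ - y₁
  left_mem : x₁ ∈ X
  right_mem : x₂ ∈ X
  lt : x₁ < x₂
  free : F x₁ x₂ y₁ y₂
  max_left : ∀ x ∈ X, F x x₂ y₁ y₂ → x₁ ≤ x
  max_right : ∀ x ∈ X, F x₁ x y₁ y₂ → x ≤ x₂

/-- The blocks of the dissection: runs in tall rows, runs in wide columns, and the cells that are
neither in a tall row nor in a wide column. -/
def IsGridBlock (F : ℝ → ℝ → ℝ → ℝ → Prop) (X Y : Finset ℝ) (M x₁ x₂ y₁ y₂ : ℝ) : Prop :=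
  IsRun F X Y M x₁ x₂ y₁ y₂ ∨ IsRun (swapAxes F) Y X M y₁ y₂ x₁ x₂ ∨
    (Consec X x₁ x₂ ∧ x₂ - x₁ ≤ M ∧ Consec Y y₁ y₂ ∧ y₂ - y₁ ≤ M ∧ F x₁ x₂ y₁ y₂)

/-- No square of side more than `M` is free. -/
def SquareBound (F : ℝ → ℝ → ℝ → ℝ → Prop) (M : ℝ) : Prop :=
  ∀ x y t, 0 < t → F x (x + t) y (y + t) → t ≤ M

section Grid

variable {F : ℝ → ℝ → ℝ → ℝ → Prop} {X Y : Finset ℝ} {M : ℝ}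

/-- The axioms are symmetric in the two axes, so each result about rows also serves for columns. -/
theorem GridRegion.swap (hF : GridRegion F X Y) : GridRegion (swapAxes F) Y X where
  mono h h₁ h₂ h₃ h₄ := hF.mono h h₃ h₄ h₁ h₂
  merge_left h h' h₁ h₂ := hF.merge_right h h' h₁ h₂
  merge_right h h' h₁ h₂ := hF.merge_left h h' h₁ h₂
  hull_left h := hF.hull_right h
  hull_right h := hF.hull_left h

theorem SquareBound.swap (hM : SquareBound F M) : SquareBound (swapAxes F) M :=
  fun x y t ht h => hM y x t ht h

theorem IsGridBlock.swap {x₁ x₂ y₁ y₂ : ℝ} (h : IsGridBlock F X Y M x₁ x₂ y₁ y₂) :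
    IsGridBlock (swapAxes F) Y X M y₁ y₂ x₁ x₂ := by
  rcases h with h | h | ⟨h₁, h₂, h₃, h₄, h₅⟩
  · exact Or.inr (Or.inl h)
  · exact Or.inl h
  · exact Or.inr (Or.inr ⟨h₃, h₄, h₁, h₂, h₅⟩)

theorem IsGridBlock.free {x₁ x₂ y₁ y₂ : ℝ} (h : IsGridBlock F X Y M x₁ x₂ y₁ y₂) :
    F x₁ x₂ y₁ y₂ := by
  rcases h with h | h | ⟨_, _, _, _, h⟩
  exacts [h.free, h.free, h]

theorem IsGridBlock.lt_left {x₁ x₂ y₁ y₂ : ℝ} (h : IsGridBlock F X Y M x₁ x₂ y₁ y₂) :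
    x₁ < x₂ := by
  rcases h with h | h | ⟨h, _⟩
  exacts [h.lt, h.row.lt, h.lt]

theorem IsGridBlock.lt_right {x₁ x₂ y₁ y₂ : ℝ} (h : IsGridBlock F X Y M x₁ x₂ y₁ y₂) :
    y₁ < y₂ := h.swap.lt_left

theorem IsGridBlock.mem_left {x₁ x₂ y₁ y₂ : ℝ} (h : IsGridBlock F X Y M x₁ x₂ y₁ y₂) :
    x₁ ∈ X ∧ x₂ ∈ X := by
  rcases h with h | h | ⟨h, _⟩
  exacts [⟨h.left_mem, h.right_mem⟩, ⟨h.row.left_mem, h.row.right_mem⟩,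
    ⟨h.left_mem, h.right_mem⟩]

theorem IsGridBlock.mem_right {x₁ x₂ y₁ y₂ : ℝ} (h : IsGridBlock F X Y M x₁ x₂ y₁ y₂) :
    y₁ ∈ Y ∧ y₂ ∈ Y := h.swap.mem_left

/-- A free cell is not contained both in a tall row and in a wide column. -/
theorem SquareBound.not_both (hF : GridRegion F X Y) (hM : SquareBound F M) (hM₀ : 0 ≤ M)
    {x₁ x₂ y₁ y₂ : ℝ} (h : F x₁ x₂ y₁ y₂) (hx : M < x₂ - x₁) (hy : M < y₂ - y₁) : False := by
  have h' := hM x₁ y₁ (min (x₂ - x₁) (y₂ - y₁)) (by simp only [lt_min_iff]; constructor <;> linarith)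
    (hF.mono h le_rfl (by linarith [min_le_left (x₂ - x₁) (y₂ - y₁)]) le_rfl
      (by linarith [min_le_right (x₂ - x₁) (y₂ - y₁)]))
  exact absurd (lt_min hx hy) (not_lt.2 h')

/-- A free rectangle within a tall row lies in a run. -/
theorem GridRegion.exists_run (hF : GridRegion F X Y) {u₁ u₂ v₁ v₂ y₁ y₂ : ℝ}
    (h : F u₁ u₂ v₁ v₂) (hu : u₁ < u₂) (hv : v₁ < v₂) (hy : Consec Y y₁ y₂) (h₁ : y₁ ≤ v₁)
    (h₂ : v₂ ≤ y₂) (htall : M < y₂ - y₁) :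
    ∃ x₁ x₂, IsRun F X Y M x₁ x₂ y₁ y₂ ∧ x₁ ≤ u₁ ∧ u₂ ≤ x₂ := by
  classical
  -- Stretching to horizontal grid lines fills the whole row, as no grid line lies strictly inside
  -- it.
  have hrow : F u₁ u₂ y₁ y₂ := by
    obtain ⟨a, ha, b, hb, hav, hvb, hab⟩ := hF.hull_right h
    refine hF.mono hab le_rfl le_rfl ?_ ?_
    · rcases hy.gap a ha with h' | h' <;> linarith
    · rcases hy.gap b hb with h' | h' <;> linarith
  obtain ⟨a, ha, b, hb, hau, hub, hab⟩ := hF.hull_left hrow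
  have hA : a ∈ X.filter fun x => F x u₂ y₁ y₂ := by
    simp only [Finset.mem_filter]
    exact ⟨ha, hF.mono hab le_rfl hub le_rfl le_rfl⟩
  -- The left end is optimised against `u₂`, and the right end afterwards against `x₁`. Since
  -- freeness passes to subrectangles, the left end remains extremal for the final `x₂`.
  set x₁ := (X.filter fun x => F x u₂ y₁ y₂).min' ⟨a, hA⟩ with hx₁
  have hx₁m := Finset.min'_mem _ ⟨a, hA⟩
  rw [← hx₁, Finset.mem_filter] at hx₁m
  have hx₁a : x₁ ≤ a := Finset.min'_le _ _ hA
  obtain ⟨a', ha', b', hb', hau', hub', hab'⟩ := hF.hull_left hx₁m.2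
  have hB : b' ∈ X.filter fun x => F x₁ x y₁ y₂ := by
    simp only [Finset.mem_filter]
    exact ⟨hb', hF.mono hab' hau' le_rfl le_rfl le_rfl⟩
  set x₂ := (X.filter fun x => F x₁ x y₁ y₂).max' ⟨b', hB⟩ with hx₂
  have hx₂m := Finset.max'_mem _ ⟨b', hB⟩
  rw [← hx₂, Finset.mem_filter] at hx₂m
  have hx₂b : b' ≤ x₂ := Finset.le_max' _ _ hB
  refine ⟨x₁, x₂, ⟨hy, htall, hx₁m.1, hx₂m.1, by linarith, hx₂m.2, fun x hx hfx => ?_,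
    fun x hx hfx => ?_⟩, by linarith, by linarith⟩
  · refine Finset.min'_le _ _ ?_
    simp only [Finset.mem_filter]
    exact ⟨hx, hF.mono hfx le_rfl (by linarith) le_rfl le_rfl⟩
  · refine Finset.le_max' _ _ ?_
    simp only [Finset.mem_filter]
    exact ⟨hx, hfx⟩

/-- Runs that overlap are equal. -/
theorem IsRun.eq_of_overlap (hF : GridRegion F X Y) {x₁ x₂ y₁ y₂ x₁' x₂' y₁' y₂' : ℝ}
    (h : IsRun F X Y M x₁ x₂ y₁ y₂) (h' : IsRun F X Y M x₁' x₂' y₁' y₂')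
    (hx : x₁ < x₂') (hx' : x₁' < x₂) (hy : y₁ < y₂') (hy' : y₁' < y₂) :
    x₁ = x₁' ∧ x₂ = x₂' ∧ y₁ = y₁' ∧ y₂ = y₂' := by
  obtain ⟨rfl, rfl⟩ := h.row.eq_or_disjoint h'.row hy hy'
  have hm := hF.merge_left h.free h'.free hx hx'
  have e₁ := h.max_left _ h'.left_mem (hF.mono hm (min_le_right _ _) (le_max_left _ _) le_rfl le_rfl)
  have e₂ := h'.max_left _ h.left_mem
    (hF.mono hm (min_le_left _ _) (le_max_right _ _) le_rfl le_rfl)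
  have e₃ := h.max_right _ h'.right_mem
    (hF.mono hm (min_le_left _ _) (le_max_right _ _) le_rfl le_rfl)
  have e₄ := h'.max_right _ h.right_mem
    (hF.mono hm (min_le_right _ _) (le_max_left _ _) le_rfl le_rfl)
  exact ⟨le_antisymm e₁ e₂, le_antisymm e₄ e₃, rfl, rfl⟩

/-- No end of the horizontal run lies strictly inside the column, so the run spans the full width of
the column. The cell where row and column meet would then be free, taller and wider than `M`. -/
theorem IsRun.not_overlap_swap (hF : GridRegion F X Y) (hM : SquareBound F M) (hM₀ : 0 ≤ M)
    {x₁ x₂ y₁ y₂ x₁' x₂' y₁' y₂' : ℝ}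
    (h : IsRun F X Y M x₁ x₂ y₁ y₂) (h' : IsRun (swapAxes F) Y X M y₁' y₂' x₁' x₂')
    (hx : x₁ < x₂') (hx' : x₁' < x₂) : False := by
  refine hM.not_both hF hM₀ (x₁ := x₁') (x₂ := x₂') (hF.mono h.free ?_ ?_ le_rfl le_rfl) h'.tall h.tall
  · rcases h'.row.gap _ h.left_mem with e | e <;> linarith
  · rcases h'.row.gap _ h.right_mem with e | e <;> linarith

/-- Blocks that overlap are equal. -/
theorem IsGridBlock.eq_of_overlap (hF : GridRegion F X Y) (hM : SquareBound F M) (hM₀ : 0 ≤ M)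
    {x₁ x₂ y₁ y₂ x₁' x₂' y₁' y₂' : ℝ}
    (h : IsGridBlock F X Y M x₁ x₂ y₁ y₂) (h' : IsGridBlock F X Y M x₁' x₂' y₁' y₂')
    (hx : x₁ < x₂') (hx' : x₁' < x₂) (hy : y₁ < y₂') (hy' : y₁' < y₂) :
    x₁ = x₁' ∧ x₂ = x₂' ∧ y₁ = y₁' ∧ y₂ = y₂' := by
  rcases h with h | h | ⟨h₁, h₂, h₃, h₄, h₅⟩ <;>
    rcases h' with h' | h' | ⟨h₁', h₂', h₃', h₄', h₅'⟩
  · exact h.eq_of_overlap hF h' hx hx' hy hy'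
  · exact (h.not_overlap_swap hF hM hM₀ h' hx hx').elim
  · obtain ⟨rfl, rfl⟩ := h.row.eq_or_disjoint h₃' hy hy'
    exact absurd h.tall (not_lt.2 h₄')
  · exact (h'.not_overlap_swap hF hM hM₀ h hx' hx).elim
  · obtain ⟨e₁, e₂, e₃, e₄⟩ := h.eq_of_overlap hF.swap h' hy hy' hx hx'
    exact ⟨e₃, e₄, e₁, e₂⟩
  · obtain ⟨rfl, rfl⟩ := h.row.eq_or_disjoint h₁' hx hx'
    exact absurd h.tall (not_lt.2 h₂')
  · obtain ⟨rfl, rfl⟩ := h₃.eq_or_disjoint h'.row hy hy'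
    exact absurd h'.tall (not_lt.2 h₄)
  · obtain ⟨rfl, rfl⟩ := h₁.eq_or_disjoint h'.row hx hx'
    exact absurd h'.tall (not_lt.2 h₂)
  · obtain ⟨rfl, rfl⟩ := h₁.eq_or_disjoint h₁' hx hx'
    obtain ⟨rfl, rfl⟩ := h₃.eq_or_disjoint h₃' hy hy'
    exact ⟨rfl, rfl, rfl, rfl⟩

/-- The rectangle `[u₁, u₂] × [v₁, v₂]` lies in one of the blocks. -/
def InGridBlock (F : ℝ → ℝ → ℝ → ℝ → Prop) (X Y : Finset ℝ) (M u₁ u₂ v₁ v₂ : ℝ) : Prop :=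
  ∃ x₁ x₂ y₁ y₂, IsGridBlock F X Y M x₁ x₂ y₁ y₂ ∧ x₁ ≤ u₁ ∧ u₂ ≤ x₂ ∧ y₁ ≤ v₁ ∧ v₂ ≤ y₂

theorem InGridBlock.swap {u₁ u₂ v₁ v₂ : ℝ} (h : InGridBlock F X Y M u₁ u₂ v₁ v₂) :
    InGridBlock (swapAxes F) Y X M v₁ v₂ u₁ u₂ := by
  obtain ⟨x₁, x₂, y₁, y₂, h, h₁, h₂, h₃, h₄⟩ := h
  exact ⟨y₁, y₂, x₁, x₂, h.swap, h₃, h₄, h₁, h₂⟩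

theorem InGridBlock.mono {u₁ u₂ v₁ v₂ u₁' u₂' v₁' v₂' : ℝ} (h : InGridBlock F X Y M u₁ u₂ v₁ v₂)
    (h₁ : u₁ ≤ u₁') (h₂ : u₂' ≤ u₂) (h₃ : v₁ ≤ v₁') (h₄ : v₂' ≤ v₂) :
    InGridBlock F X Y M u₁' u₂' v₁' v₂' := by
  obtain ⟨x₁, x₂, y₁, y₂, h, k₁, k₂, k₃, k₄⟩ := h
  exact ⟨x₁, x₂, y₁, y₂, h, by linarith, by linarith, by linarith, by linarith⟩

/-- The cell that contains the lower left corner of a free rectangle. -/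
theorem GridRegion.exists_cell (hF : GridRegion F X Y) {u₁ u₂ v₁ v₂ : ℝ}
    (h : F u₁ u₂ v₁ v₂) (hu : u₁ < u₂) (hv : v₁ < v₂) :
    ∃ a a' b b', Consec X a a' ∧ Consec Y b b' ∧ F a a' b b' ∧ a ≤ u₁ ∧ u₁ < a' ∧ b ≤ v₁ ∧
      v₁ < b' := by
  obtain ⟨x₁, hx₁, x₂, hx₂, h₁, h₂, h'⟩ := hF.hull_left h
  obtain ⟨y₁, hy₁, y₂, hy₂, k₁, k₂, h''⟩ := hF.hull_right h'
  obtain ⟨a, a', ha, hau, hua⟩ := Consec.exists_of_mem hx₁ hx₂ h₁ (by linarith)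
  obtain ⟨b, b', hb, hbv, hvb⟩ := Consec.exists_of_mem hy₁ hy₂ k₁ (by linarith)
  refine ⟨a, a', b, b', ha, hb, hF.mono h'' ?_ ?_ ?_ ?_, hau, hua, hbv, hvb⟩
  · rcases ha.gap _ hx₁ with e | e <;> linarith
  · rcases ha.gap _ hx₂ with e | e <;> linarith
  · rcases hb.gap _ hy₁ with e | e <;> linarith
  · rcases hb.gap _ hy₂ with e | e <;> linarith

/-- A free rectangle of height more than `M` that no horizontal line of the grid crosses lies in a
block. -/
theorem GridRegion.inGridBlock_of_tall (hF : GridRegion F X Y) {u₁ u₂ v₁ v₂ : ℝ}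
    (h : F u₁ u₂ v₁ v₂) (hu : u₁ < u₂) (hv : v₁ < v₂) (htall : M < v₂ - v₁)
    (hY : ∀ y ∈ Y, y ≤ v₁ ∨ v₂ ≤ y) : InGridBlock F X Y M u₁ u₂ v₁ v₂ := by
  obtain ⟨a, a', b, b', ha, hb, -, -, -, hbv, hvb⟩ := hF.exists_cell h hu hv
  have hb' : v₂ ≤ b' := by rcases hY _ hb.right_mem with e | e <;> linarith
  obtain ⟨x₁, x₂, hr, h₁, h₂⟩ := hF.exists_run (M := M) h hu hv hb hbv hb' (by linarith)
  exact ⟨x₁, x₂, b, b', Or.inl hr, h₁, h₂, hbv, hb'⟩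

/-- A free rectangle that no line of the grid crosses lies in a block. -/
theorem GridRegion.inGridBlock_of_not_crossed (hF : GridRegion F X Y) {u₁ u₂ v₁ v₂ : ℝ}
    (h : F u₁ u₂ v₁ v₂) (hu : u₁ < u₂) (hv : v₁ < v₂)
    (hX : ∀ x ∈ X, x ≤ u₁ ∨ u₂ ≤ x) (hY : ∀ y ∈ Y, y ≤ v₁ ∨ v₂ ≤ y) :
    InGridBlock F X Y M u₁ u₂ v₁ v₂ := by
  obtain ⟨a, a', b, b', ha, hb, hab, hau, hua, hbv, hvb⟩ := hF.exists_cell h hu hv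
  have ha' : u₂ ≤ a' := by rcases hX _ ha.right_mem with e | e <;> linarith
  have hb' : v₂ ≤ b' := by rcases hY _ hb.right_mem with e | e <;> linarith
  rcases lt_or_ge M (b' - b) with hM | hM
  · obtain ⟨x₁, x₂, hr, h₁, h₂⟩ := hF.exists_run h hu hv hb hbv hb' hM
    exact ⟨x₁, x₂, b, b', Or.inl hr, h₁, h₂, hbv, hb'⟩
  rcases lt_or_ge M (a' - a) with hM' | hM'
  · obtain ⟨y₁, y₂, hr, h₁, h₂⟩ := hF.swap.exists_run h hv hu ha hau ha' hM'
    exact ⟨a, a', y₁, y₂, Or.inr (Or.inl hr), hau, ha', h₁, h₂⟩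
  · exact ⟨a, a', b, b', Or.inr (Or.inr ⟨ha, hM', hb, hM, hab⟩), hau, ha', hbv, hb'⟩

/-- The rectangle `[u₁, u₂] × [v₁, v₂]` crosses the line with abscissa `x` in the row of height at
most `M` that starts at `y`. -/
def CrossesAt (Y : Finset ℝ) (M x y u₁ u₂ v₁ v₂ : ℝ) : Prop :=
  u₁ < x ∧ x < u₂ ∧ ∃ y', Consec Y y y' ∧ y' - y ≤ M ∧ y < v₂ ∧ v₁ < y'

/-- The cell at the lower left corner decides. If its row is short, the crossed vertical line is
crossed along a short edge. If its row is tall, the rectangle either stays in it and lies in a run,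
or it leaves through the top; the column of the cell is then short, since a free cell cannot be both
wide and tall, and the top edge is a crossed short edge. -/
theorem GridRegion.inGridBlock_or_crosses_of_crossed (hF : GridRegion F X Y)
    (hM : SquareBound F M) (hM₀ : 0 ≤ M) {u₁ u₂ v₁ v₂ : ℝ}
    (h : F u₁ u₂ v₁ v₂) (hu : u₁ < u₂) (hv : v₁ < v₂) {x : ℝ} (hx : x ∈ X) (hux : u₁ < x)
    (hxu : x < u₂) :
    InGridBlock F X Y M u₁ u₂ v₁ v₂ ∨ (∃ x ∈ X, ∃ y ∈ Y, CrossesAt Y M x y u₁ u₂ v₁ v₂) ∨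
      ∃ y ∈ Y, ∃ x ∈ X, CrossesAt X M y x v₁ v₂ u₁ u₂ := by
  obtain ⟨a, a', b, b', ha, hb, hab, hau, hua, hbv, hvb⟩ := hF.exists_cell h hu hv
  rcases le_or_gt (b' - b) M with hbM | hbM
  · exact Or.inr (Or.inl ⟨x, hx, b, hb.left_mem, hux, hxu, b', hb, hbM, by linarith, by linarith⟩)
  rcases le_or_gt v₂ b' with hvb' | hvb'
  · obtain ⟨x₁, x₂, hr, h₁, h₂⟩ := hF.exists_run h hu hv hb hbv hvb' hbM
    exact Or.inl ⟨x₁, x₂, b, b', Or.inl hr, h₁, h₂, hbv, hvb'⟩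
  rcases le_or_gt (a' - a) M with haM | haM
  · exact Or.inr (Or.inr ⟨b', hb.right_mem, a, ha.left_mem, hvb, hvb', a', ha, haM, by linarith,
      by linarith⟩)
  · exact (hM.not_both hF hM₀ hab haM hbM).elim

/-- A free rectangle that is not contained in a block crosses a short edge of the grid. -/
theorem GridRegion.inGridBlock_or_crosses (hF : GridRegion F X Y)
    (hM : SquareBound F M) (hM₀ : 0 ≤ M) {u₁ u₂ v₁ v₂ : ℝ}
    (h : F u₁ u₂ v₁ v₂) (hu : u₁ < u₂) (hv : v₁ < v₂) :
    InGridBlock F X Y M u₁ u₂ v₁ v₂ ∨ (∃ x ∈ X, ∃ y ∈ Y, CrossesAt Y M x y u₁ u₂ v₁ v₂) ∨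
      ∃ y ∈ Y, ∃ x ∈ X, CrossesAt X M y x v₁ v₂ u₁ u₂ := by
  by_cases hX : ∀ x ∈ X, x ≤ u₁ ∨ u₂ ≤ x
  · by_cases hY : ∀ y ∈ Y, y ≤ v₁ ∨ v₂ ≤ y
    · exact Or.inl (hF.inGridBlock_of_not_crossed h hu hv hX hY)
    · push Not at hY
      obtain ⟨y, hy, h₁, h₂⟩ := hY
      rcases hF.swap.inGridBlock_or_crosses_of_crossed hM.swap hM₀ h hv hu hy h₁ h₂ with e | e | e
      exacts [Or.inl e.swap, Or.inr (Or.inr e), Or.inr (Or.inl e)]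
  · push Not at hX
    obtain ⟨x, hx, h₁, h₂⟩ := hX
    exact hF.inGridBlock_or_crosses_of_crossed hM hM₀ h hu hv hx h₁ h₂

end Grid

/-! ### Crossing squares, stacking and averaging over strips -/

/-- Disjoint intervals within `[α, β]` have total length at most `β - α`. -/
theorem sum_length_le_of_disjoint {ι : Type*} (s : Finset ι) (v t : ι → ℝ) {α β : ℝ} (hαβ : α ≤ β)
    (ht : ∀ j ∈ s, 0 ≤ t j) (hα : ∀ j ∈ s, α ≤ v j) (hβ : ∀ j ∈ s, v j + t j ≤ β)
    (hd : ∀ j ∈ s, ∀ l ∈ s, j ≠ l → v j + t j ≤ v l ∨ v l + t l ≤ v j) :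
    ∑ j ∈ s, t j ≤ β - α := by
  have h₁ : MeasureTheory.volume (⋃ j ∈ s, Ioc (v j) (v j + t j)) =
      ∑ j ∈ s, ENNReal.ofReal (t j) := by
    rw [MeasureTheory.measure_biUnion_finset]
    · simp
    · intro j hj l hl hjl
      rw [Function.onFun, Set.disjoint_left]
      rintro x ⟨h₁, h₂⟩ ⟨h₃, h₄⟩
      rcases hd j hj l hl hjl with h | h <;> linarith
    · exact fun j _ => measurableSet_Ioc
  have h₂ : (⋃ j ∈ s, Ioc (v j) (v j + t j)) ⊆ Icc α β := by
    refine iUnion₂_subset fun j hj x hx => ⟨?_, ?_⟩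
    · linarith [hx.1, hα j hj]
    · linarith [hx.2, hβ j hj]
  have h₃ := MeasureTheory.measure_mono (μ := MeasureTheory.volume) h₂
  rw [h₁, Real.volume_Icc, ← ENNReal.ofReal_sum_of_nonneg ht,
    ENNReal.ofReal_le_ofReal_iff (by linarith)] at h₃
  exact h₃

/-- The axis-parallel squares with lower left corners `(u₁, v₁)`, `(u₂, v₂)` and sides `t₁`, `t₂` do
not overlap. -/
def SquaresSeparated (u₁ v₁ t₁ u₂ v₂ t₂ : ℝ) : Prop :=
  u₁ + t₁ ≤ u₂ ∨ u₂ + t₂ ≤ u₁ ∨ v₁ + t₁ ≤ v₂ ∨ v₂ + t₂ ≤ v₁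

theorem SquaresSeparated.swap {u₁ v₁ t₁ u₂ v₂ t₂ : ℝ} (h : SquaresSeparated u₁ v₁ t₁ u₂ v₂ t₂) :
    SquaresSeparated v₁ u₁ t₁ v₂ u₂ t₂ := by
  unfold SquaresSeparated at *
  tauto

/-- Squares that cross a common short edge of the grid have total side length at most three times
the bound on the edge length. -/
theorem sum_side_crossesAt_le {ι : Type*} (s : Finset ι) (u v t : ι → ℝ) {Y : Finset ℝ}
    {M x y : ℝ} (hM₀ : 0 ≤ M) (ht : ∀ j ∈ s, 0 < t j) (htM : ∀ j ∈ s, t j ≤ M)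
    (hsep : ∀ j ∈ s, ∀ l ∈ s, j ≠ l → SquaresSeparated (u j) (v j) (t j) (u l) (v l) (t l))
    (hc : ∀ j ∈ s, CrossesAt Y M x y (u j) (u j + t j) (v j) (v j + t j)) :
    ∑ j ∈ s, t j ≤ 3 * M := by
  -- All the squares straddle the same vertical line, so their vertical projections are disjoint.
  -- Each meets an interval of length at most `M` starting at `y` and has side at most `M`, which
  -- gives the window of length `3 * M`.
  have key := sum_length_le_of_disjoint s v t (α := y - M) (β := y + 2 * M) (by linarith)
    (fun j hj => (ht j hj).le) (fun j hj => ?_) (fun j hj => ?_) (fun j hj l hl hjl => ?_)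
  · linarith
  · obtain ⟨_, _, y', hy, _, h₁, h₂⟩ := hc j hj
    linarith [htM j hj]
  · obtain ⟨_, _, y', hy, _, h₁, h₂⟩ := hc j hj
    linarith [htM j hj]
  · obtain ⟨h₁, h₂, _⟩ := hc j hj
    obtain ⟨h₃, h₄, _⟩ := hc l hl
    rcases hsep j hj l hl hjl with h | h | h | h
    · linarith
    · linarith
    · exact Or.inl h
    · exact Or.inr h

/-- Squares of total side length at most `ℓ` can be stacked in a strip of height `ℓ`. -/
theorem exists_stacking {n : ℕ} (C : Finset (Fin n)) (t : Fin n → ℝ) {y ℓ : ℝ}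
    (ht : ∀ j ∈ C, 0 ≤ t j) (hsum : ∑ j ∈ C, t j ≤ ℓ) :
    ∃ v : Fin n → ℝ, (∀ j ∈ C, y ≤ v j ∧ v j + t j ≤ y + ℓ) ∧
      ∀ j ∈ C, ∀ l ∈ C, j ≠ l → v j + t j ≤ v l ∨ v l + t l ≤ v j := by
  classical
  have hlt : ∀ j ∈ C, ∀ l, j < l →
      ∑ k ∈ C.filter (· < j), t k + t j ≤ ∑ k ∈ C.filter (· < l), t k := by
    intro j hj l hjl
    rw [add_comm, ← Finset.sum_insert (s := C.filter (· < j)) (by simp)]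
    refine Finset.sum_le_sum_of_subset_of_nonneg ?_ fun k hk _ =>
      ht k (Finset.mem_filter.1 hk).1
    intro k hk
    simp only [Finset.mem_insert, Finset.mem_filter] at hk ⊢
    rcases hk with rfl | ⟨h₁, h₂⟩
    exacts [⟨hj, hjl⟩, ⟨h₁, h₂.trans hjl⟩]
  refine ⟨fun j => y + ∑ k ∈ C.filter (· < j), t k, fun j hj => ⟨?_, ?_⟩, fun j hj l hl hjl => ?_⟩
  · have : 0 ≤ ∑ k ∈ C.filter (· < j), t k :=
      Finset.sum_nonneg fun k hk => ht k (Finset.mem_filter.1 hk).1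
    linarith
  · have : ∑ k ∈ C.filter (· < j), t k + t j ≤ ∑ k ∈ C, t k := by
      rw [add_comm, ← Finset.sum_insert (s := C.filter (· < j)) (by simp)]
      refine Finset.sum_le_sum_of_subset_of_nonneg ?_ fun k hk _ => ht k hk
      intro k hk
      simp only [Finset.mem_insert, Finset.mem_filter] at hk
      rcases hk with rfl | ⟨h₁, h₂⟩
      exacts [hj, h₁]
    linarith
  · rcases lt_or_gt_of_ne hjl with h | h
    · exact Or.inl (by linarith [hlt j hj l h])
    · exact Or.inr (by linarith [hlt l hl j h])

/-- An interval of length at most `ℓ` meets at most two of the intervals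
`(y + k ℓ, y + (k + 1) ℓ)`. -/
theorem card_strips_met_le {y v t ℓ : ℝ} (hℓ : 0 < ℓ) (ht : t ≤ ℓ) (T : ℕ) :
    ((Finset.range T).filter fun k : ℕ =>
      v < y + (k + 1) * ℓ ∧ y + k * ℓ < v + t).card ≤ 2 := by
  set A := (Finset.range T).filter fun k : ℕ => v < y + (k + 1) * ℓ ∧ y + k * ℓ < v + t
  rcases A.eq_empty_or_nonempty with h | h
  · simp [h]
  have hsub : A ⊆ {A.min' h, A.min' h + 1} := by
    intro k hk
    have h₁ := (Finset.mem_filter.1 (A.min'_mem h)).2.1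
    have h₂ := (Finset.mem_filter.1 hk).2.2
    have h₃ := A.min'_le k hk
    have h₄ : (k : ℝ) * ℓ < (A.min' h + 2) * ℓ := by linarith
    have h₅ : (k : ℝ) < A.min' h + 2 := lt_of_mul_lt_mul_right h₄ hℓ.le
    have h₆ : k < A.min' h + 2 := by exact_mod_cast h₅
    simp only [Finset.mem_insert, Finset.mem_singleton]
    omega
  exact (Finset.card_le_card hsub).trans Finset.card_le_two

/-- Among many consecutive strips there is one that is crossed by no line of the grid and whose
items carry little profit. -/
theorem exists_cheap_strip {ι : Type*} (S : Finset ι) (v t p : ι → ℝ) (Y : Finset ℝ) {y ℓ ε : ℝ}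
    {T : ℕ} (hℓ : 0 < ℓ) (ht : ∀ j ∈ S, t j ≤ ℓ) (hp : ∀ j ∈ S, 0 ≤ p j) (hε : 0 < ε)
    (hT : 2 ≤ ((T : ℝ) - Y.card) * ε) :
    ∃ k < T, (∀ z ∈ Y, z ≤ y + k * ℓ ∨ y + (k + 1) * ℓ ≤ z) ∧
      ∑ j ∈ S with v j < y + (k + 1) * ℓ ∧ y + k * ℓ < v j + t j, p j ≤ ε * ∑ j ∈ S, p j := by
  classical
  set bad := (Finset.range T).filter fun k : ℕ => ∃ z ∈ Y, y + k * ℓ < z ∧ z < y + (k + 1) * ℓ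
    with hbad
  set good := Finset.range T \ bad with hgood
  -- Strips have disjoint interiors, so choosing a crossing line for each bad strip is injective.
  have hbadcard : bad.card ≤ Y.card := by
    have hex : ∀ k ∈ bad, ∃ z ∈ Y, y + k * ℓ < z ∧ z < y + (k + 1) * ℓ :=
      fun k hk => (Finset.mem_filter.1 hk).2
    choose! f hf using hex
    refine Finset.card_le_card_of_injOn f (fun k hk => (hf k hk).1) fun k hk l hl hkl => ?_
    have h₁ := (hf k hk).2
    have h₂ := (hf l hl).2
    rw [hkl] at h₁
    have h₃ : (k : ℝ) * ℓ < (l + 1) * ℓ := by linarith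
    have h₄ : (l : ℝ) * ℓ < (k + 1) * ℓ := by linarith
    have h₅ : (k : ℝ) < l + 1 := lt_of_mul_lt_mul_right h₃ hℓ.le
    have h₆ : (l : ℝ) < k + 1 := lt_of_mul_lt_mul_right h₄ hℓ.le
    have h₇ : k < l + 1 := by exact_mod_cast h₅
    have h₈ : l < k + 1 := by exact_mod_cast h₆
    omega
  have hgoodcard : (T : ℝ) - Y.card ≤ good.card := by
    have h := Finset.card_sdiff_add_card_eq_card (s := bad) (t := Finset.range T)
      (Finset.filter_subset _ _)
    rw [Finset.card_range, ← hgood] at h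
    have h' : T ≤ good.card + Y.card := by omega
    have : (T : ℝ) ≤ good.card + Y.card := by exact_mod_cast h'
    linarith
  have hpos : 0 < (T : ℝ) - Y.card := by
    by_contra hneg
    nlinarith
  have hne : good.Nonempty := by
    rw [← Finset.card_pos]
    exact_mod_cast hpos.trans_le hgoodcard
  -- Double counting: an item no taller than a strip meets at most two of them.
  have hsum : ∑ k ∈ good, ∑ j ∈ S with v j < y + ((k : ℝ) + 1) * ℓ ∧ y + k * ℓ < v j + t j, p j ≤
      2 * ∑ j ∈ S, p j := by
    calc ∑ k ∈ good, ∑ j ∈ S with v j < y + ((k : ℝ) + 1) * ℓ ∧ y + k * ℓ < v j + t j, p j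
        = ∑ j ∈ S, ∑ k ∈ good.filter fun k : ℕ =>
            v j < y + ((k : ℝ) + 1) * ℓ ∧ y + k * ℓ < v j + t j, p j := by
          simp only [Finset.sum_filter]
          exact Finset.sum_comm
      _ ≤ ∑ j ∈ S, 2 * p j := by
          refine Finset.sum_le_sum fun j hj => ?_
          rw [Finset.sum_const, nsmul_eq_mul]
          refine mul_le_mul_of_nonneg_right ?_ (hp j hj)
          have h₁ := card_strips_met_le (y := y) (v := v j) hℓ (ht j hj) T
          have h₂ := Finset.card_le_card (Finset.filter_subset_filter
            (fun k : ℕ => v j < y + ((k : ℝ) + 1) * ℓ ∧ y + (k : ℝ) * ℓ < v j + t j)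
            (Finset.sdiff_subset : good ⊆ Finset.range T))
          exact_mod_cast h₂.trans h₁
      _ = 2 * ∑ j ∈ S, p j := by rw [Finset.mul_sum]
  have hP : 0 ≤ ∑ j ∈ S, p j := Finset.sum_nonneg hp
  obtain ⟨k, hk, hkle⟩ := Finset.exists_le_of_sum_le hne
    (f := fun k : ℕ => ∑ j ∈ S with v j < y + ((k : ℝ) + 1) * ℓ ∧ y + k * ℓ < v j + t j, p j)
    (g := fun _ => ε * ∑ j ∈ S, p j) (by
      rw [Finset.sum_const, nsmul_eq_mul]
      refine hsum.trans ?_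
      rw [← mul_assoc]
      exact mul_le_mul_of_nonneg_right (hT.trans (mul_le_mul_of_nonneg_right hgoodcard hε.le)) hP)
  have hk' := Finset.mem_sdiff.1 hk
  refine ⟨k, Finset.mem_range.1 hk'.1, fun z hz => ?_, hkle⟩
  by_contra! hcon
  exact hk'.2 (Finset.mem_filter.2 ⟨hk'.1, z, hz, hcon.1, hcon.2⟩)

/-! ### Repacking into the blocks -/

section Repack

variable {F : ℝ → ℝ → ℝ → ℝ → Prop} {X Y : Finset ℝ} {M : ℝ}

/-- The items that cross the short edges of the grid have small total side length. -/
theorem sum_side_crossing_le {ι : Type*} (C : Finset ι) (u v t : ι → ℝ) (hM₀ : 0 ≤ M)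
    (hX : X.card ≤ 10) (hY : Y.card ≤ 10) (ht : ∀ j ∈ C, 0 < t j) (htM : ∀ j ∈ C, t j ≤ M)
    (hsep : ∀ j ∈ C, ∀ l ∈ C, j ≠ l → SquaresSeparated (u j) (v j) (t j) (u l) (v l) (t l))
    (hc : ∀ j ∈ C, ∃ x ∈ X, ∃ y ∈ Y, CrossesAt Y M x y (u j) (u j + t j) (v j) (v j + t j)) :
    ∑ j ∈ C, t j ≤ 300 * M := by
  classical
  -- Each item is charged to all the short edges it crosses, at least one. At most `10 * 10` edges,
  -- with `3 * M` each, give `300 * M`.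
  have hle : ∑ j ∈ C, t j ≤ ∑ j ∈ C, ∑ z ∈ X ×ˢ Y,
      if CrossesAt Y M z.1 z.2 (u j) (u j + t j) (v j) (v j + t j) then t j else 0 := by
    refine Finset.sum_le_sum fun j hj => ?_
    obtain ⟨x, hx, y, hy, hxy⟩ := hc j hj
    have h := Finset.single_le_sum (s := X ×ˢ Y) (a := (x, y))
      (f := fun z => if CrossesAt Y M z.1 z.2 (u j) (u j + t j) (v j) (v j + t j) then t j else 0)
      (fun z _ => by
        have := (ht j hj).le
        positivity) (Finset.mem_product.2 ⟨hx, hy⟩)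
    simpa only [if_pos hxy] using h
  rw [Finset.sum_comm] at hle
  have hbound : ∀ z ∈ X ×ˢ Y, (∑ j ∈ C,
      if CrossesAt Y M z.1 z.2 (u j) (u j + t j) (v j) (v j + t j) then t j else 0) ≤ 3 * M := by
    intro z _
    rw [← Finset.sum_filter]
    exact sum_side_crossesAt_le _ u v t hM₀ (fun j hj => ht j (Finset.mem_filter.1 hj).1)
      (fun j hj => htM j (Finset.mem_filter.1 hj).1)
      (fun j hj l hl => hsep j (Finset.mem_filter.1 hj).1 l (Finset.mem_filter.1 hl).1)
      (fun j hj => (Finset.mem_filter.1 hj).2)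
  have h := Finset.sum_le_card_nsmul _ _ _ hbound
  have hcard : ((X ×ˢ Y).card : ℝ) ≤ 100 := by
    rw [Finset.card_product]
    exact_mod_cast Nat.mul_le_mul hX hY
  rw [nsmul_eq_mul] at h
  nlinarith

/-- Conclusion of the repacking: a part of the items of `S` of almost the same total profit can be
placed within the blocks. -/
def CanRepack (F : ℝ → ℝ → ℝ → ℝ → Prop) (X Y : Finset ℝ) (M ε : ℝ) {n : ℕ} (S : Finset (Fin n))
    (t p : Fin n → ℝ) : Prop :=
  ∃ S' ⊆ S, ∃ u v : Fin n → ℝ,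
    (∀ j ∈ S', InGridBlock F X Y M (u j) (u j + t j) (v j) (v j + t j)) ∧
    (∀ j ∈ S', ∀ l ∈ S', j ≠ l → SquaresSeparated (u j) (v j) (t j) (u l) (v l) (t l)) ∧
    (1 - ε) * ∑ j ∈ S, p j ≤ ∑ j ∈ S', p j

theorem CanRepack.swap {ε : ℝ} {n : ℕ} {S : Finset (Fin n)} {t p : Fin n → ℝ}
    (h : CanRepack F X Y M ε S t p) : CanRepack (swapAxes F) Y X M ε S t p := by
  obtain ⟨S', hS, u, v, h₁, h₂, h₃⟩ := h
  exact ⟨S', hS, v, u, fun j hj => (h₁ j hj).swap, fun j hj l hl hjl => (h₂ j hj l hl hjl).swap, h₃⟩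

/-- If there is a long vertical arm that is as wide as any free square, then the items of a packing
of the region can be repacked into the blocks with small loss. -/
theorem GridRegion.canRepack (hF : GridRegion F X Y) (hM : SquareBound F M) (hM₀ : 0 < M)
    (hX : X.card ≤ 10) (hY : Y.card ≤ 10) {ε D x₀ y₀ : ℝ} (hε : 0 < ε) (hε₁ : ε ≤ 1 / 4)
    (hD : 3000 * M ≤ ε * D) (harm : F x₀ (x₀ + M) y₀ (y₀ + D)) {n : ℕ} (S : Finset (Fin n))
    (u v t p : Fin n → ℝ) (ht : ∀ j ∈ S, 0 < t j) (hp : ∀ j ∈ S, 0 ≤ p j)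
    (hfree : ∀ j ∈ S, F (u j) (u j + t j) (v j) (v j + t j))
    (hsep : ∀ j ∈ S, ∀ l ∈ S, j ≠ l → SquaresSeparated (u j) (v j) (t j) (u l) (v l) (t l)) :
    CanRepack F X Y M ε S t p := by
  classical
  have htM : ∀ j ∈ S, t j ≤ M := fun j hj => hM _ _ _ (ht j hj) (hfree j hj)
  set C := S.filter fun j => ¬ InGridBlock F X Y M (u j) (u j + t j) (v j) (v j + t j) with hC
  have hCS : C ⊆ S := Finset.filter_subset _ _
  have hCsum : ∑ j ∈ C, t j ≤ 600 * M := by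
    -- Items crossing a vertical short edge are split off; the others cross a horizontal one. Each
    -- group contributes at most `300 * M`.
    set C₁ := C.filter fun j =>
      ∃ x ∈ X, ∃ y ∈ Y, CrossesAt Y M x y (u j) (u j + t j) (v j) (v j + t j) with hC₁
    have h₁ : ∑ j ∈ C₁, t j ≤ 300 * M := by
      have hsub : C₁ ⊆ S := (Finset.filter_subset _ _).trans hCS
      exact sum_side_crossing_le C₁ u v t hM₀.le hX hY (fun j hj => ht j (hsub hj))
        (fun j hj => htM j (hsub hj)) (fun j hj l hl => hsep j (hsub hj) l (hsub hl))
        (fun j hj => (Finset.mem_filter.1 hj).2)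
    have h₂ : ∑ j ∈ C \ C₁, t j ≤ 300 * M := by
      have hsub : C \ C₁ ⊆ S := Finset.sdiff_subset.trans hCS
      refine sum_side_crossing_le (C \ C₁) v u t hM₀.le hY hX (fun j hj => ht j (hsub hj))
        (fun j hj => htM j (hsub hj)) (fun j hj l hl hjl => (hsep j (hsub hj) l (hsub hl) hjl).swap)
        (fun j hj => ?_)
      have hjC := (Finset.mem_sdiff.1 hj)
      rcases hF.inGridBlock_or_crosses hM hM₀.le (hfree j (hsub hj))
        (by linarith [ht j (hsub hj)]) (by linarith [ht j (hsub hj)]) with h | h | h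
      · exact absurd h (Finset.mem_filter.1 hjC.1).2
      · exact absurd (Finset.mem_filter.2 ⟨hjC.1, h⟩) hjC.2
      · exact h
    have h₃ := Finset.sum_sdiff (f := t) (Finset.filter_subset _ _ : C₁ ⊆ C)
    linarith
  set ℓ := 600 * M with hℓ
  have hℓ₀ : 0 < ℓ := by positivity
  -- Ten strips may be lost to grid lines; the other `2 / ε` are needed for the averaging.
  set T := ⌈2 / ε⌉₊ + 10 with hT
  have hTlow : 2 / ε + 10 ≤ T := by
    rw [hT]
    push_cast
    linarith [Nat.le_ceil (2 / ε)]
  have hThigh : (T : ℝ) < 2 / ε + 11 := by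
    rw [hT]
    push_cast
    linarith [Nat.ceil_lt_add_one (a := 2 / ε) (by positivity)]
  have hYr : (Y.card : ℝ) ≤ 10 := by exact_mod_cast hY
  obtain ⟨k, hkT, hkY, hkp⟩ := exists_cheap_strip S v t p Y (y := y₀) (ℓ := ℓ) (ε := ε) (T := T)
    hℓ₀ (fun j hj => (htM j hj).trans (by linarith)) hp hε (by
      have h₁ : 2 / ε ≤ (T : ℝ) - Y.card := by linarith
      rwa [div_le_iff₀ hε] at h₁)
  have hkT' : (k : ℝ) + 1 ≤ T := by exact_mod_cast hkT
  -- As `ε ≤ 1 / 4`, `ε * T` is at most `2 + 11 / 4`, and `600 * (2 + 11 / 4) = 2850` is below the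
  -- available `3000`.
  have hTℓ : T * ℓ ≤ D := by
    have h₁ : ε * T ≤ 2 + 11 * ε := by
      have := mul_lt_mul_of_pos_left hThigh hε
      rw [mul_add, mul_div_cancel₀ _ hε.ne'] at this
      linarith
    have h₂ : ε * (T * ℓ) ≤ ε * D := by nlinarith
    exact le_of_mul_le_mul_left h₂ hε
  have hktop : (k + 1) * ℓ ≤ D := (mul_le_mul_of_nonneg_right hkT' hℓ₀.le).trans hTℓ
  have hk₀ : 0 ≤ (k : ℝ) * ℓ := by positivity
  -- The strip is taller than `M` and crossed by no horizontal grid line, so it sits inside a single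
  -- run.
  have hstrip : InGridBlock F X Y M x₀ (x₀ + M) (y₀ + k * ℓ) (y₀ + (k + 1) * ℓ) :=
    hF.inGridBlock_of_tall (hF.mono harm le_rfl le_rfl (by linarith) (by linarith))
      (by linarith) (by linarith) (by linarith) hkY
  obtain ⟨w, hw, hwsep⟩ := exists_stacking C t (y := y₀ + k * ℓ) (ℓ := ℓ)
    (fun j hj => (ht j (hCS hj)).le) hCsum
  -- These items are sacrificed, including any crossing items that meet the strip; what remains of
  -- `C` is moved into the strip.
  set Z := S.filter fun j => v j < y₀ + ((k : ℝ) + 1) * ℓ ∧ y₀ + k * ℓ < v j + t j with hZ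
  have hout : ∀ j ∈ S \ Z, y₀ + ((k : ℝ) + 1) * ℓ ≤ v j ∨ v j + t j ≤ y₀ + k * ℓ := by
    intro j hj
    obtain ⟨h₁, h₂⟩ := Finset.mem_sdiff.1 hj
    by_contra! hcon
    exact h₂ (Finset.mem_filter.2 ⟨h₁, hcon⟩)
  refine ⟨S \ Z, Finset.sdiff_subset, fun j => if j ∈ C then x₀ else u j,
    fun j => if j ∈ C then w j else v j, fun j hj => ?_, fun j hj l hl hjl => ?_, ?_⟩
  · by_cases hjC : j ∈ C
    · simp only [if_pos hjC]
      exact hstrip.mono le_rfl (by linarith [htM j (hCS hjC)]) (hw j hjC).1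
        (by linarith [(hw j hjC).2])
    · simp only [if_neg hjC]
      by_contra hcon
      exact hjC (Finset.mem_filter.2 ⟨(Finset.mem_sdiff.1 hj).1, hcon⟩)
  · by_cases hjC : j ∈ C <;> by_cases hlC : l ∈ C
    · simp only [if_pos hjC, if_pos hlC]
      exact Or.inr (Or.inr (hwsep j hjC l hlC hjl))
    · simp only [if_pos hjC, if_neg hlC]
      rcases hout l hl with h | h
      · exact Or.inr (Or.inr (Or.inl (by linarith [(hw j hjC).2])))
      · exact Or.inr (Or.inr (Or.inr (by linarith [(hw j hjC).1])))
    · simp only [if_neg hjC, if_pos hlC]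
      rcases hout j hj with h | h
      · exact Or.inr (Or.inr (Or.inr (by linarith [(hw l hlC).2])))
      · exact Or.inr (Or.inr (Or.inl (by linarith [(hw l hlC).1])))
    · simp only [if_neg hjC, if_neg hlC]
      exact hsep j (Finset.mem_sdiff.1 hj).1 l (Finset.mem_sdiff.1 hl).1 hjl
  · have h := Finset.sum_sdiff (f := p) (Finset.filter_subset _ _ : Z ⊆ S)
    linarith

end Repack

/-! ### Free rectangles beside tightly packed large squares -/

namespace PlacedSquare

/-- The mirror image of a square in the diagonal. -/
def transpose (q : PlacedSquare) : PlacedSquare := ⟨q.y, q.x, q.side⟩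

/-- The rectangle `[x₁, x₂] × [y₁, y₂]` does not overlap the square. -/
def Avoids (q : PlacedSquare) (x₁ x₂ y₁ y₂ : ℝ) : Prop :=
  x₂ ≤ q.x ∨ q.x + q.side ≤ x₁ ∨ y₂ ≤ q.y ∨ q.y + q.side ≤ y₁

theorem avoids_transpose {q : PlacedSquare} {x₁ x₂ y₁ y₂ : ℝ} :
    q.transpose.Avoids y₁ y₂ x₁ x₂ ↔ q.Avoids x₁ x₂ y₁ y₂ := by
  simp only [Avoids, transpose]
  tauto

end PlacedSquare

/-- The rectangle `[x₁, x₂] × [y₁, y₂]` lies in the bin `[0, W] × [0, H]` and does not overlap any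
square of `Q`. -/
structure FreeRect (W H : ℝ) (Q : List PlacedSquare) (x₁ x₂ y₁ y₂ : ℝ) : Prop where
  left : 0 ≤ x₁
  right : x₂ ≤ W
  bottom : 0 ≤ y₁
  top : y₂ ≤ H
  avoids : ∀ q ∈ Q, q.Avoids x₁ x₂ y₁ y₂

theorem FreeRect.transpose {W H : ℝ} {Q : List PlacedSquare} {x₁ x₂ y₁ y₂ : ℝ}
    (h : FreeRect W H Q x₁ x₂ y₁ y₂) :
    FreeRect H W (Q.map PlacedSquare.transpose) y₁ y₂ x₁ x₂ := by
  refine ⟨h.bottom, h.top, h.left, h.right, fun q hq => ?_⟩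
  obtain ⟨q', hq', rfl⟩ := List.mem_map.1 hq
  exact PlacedSquare.avoids_transpose.2 (h.avoids q' hq')

theorem map_transpose_map_transpose (Q : List PlacedSquare) :
    (Q.map PlacedSquare.transpose).map PlacedSquare.transpose = Q := by
  rw [List.map_map]
  exact List.map_id Q

theorem freeRect_transpose {W H : ℝ} {Q : List PlacedSquare} {x₁ x₂ y₁ y₂ : ℝ} :
    FreeRect H W (Q.map PlacedSquare.transpose) y₁ y₂ x₁ x₂ ↔ FreeRect W H Q x₁ x₂ y₁ y₂ := by
  refine ⟨fun h => ?_, fun h => h.transpose⟩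
  have h' := h.transpose
  rwa [map_transpose_map_transpose] at h'

/-- The left or the right side of `q` is at the boundary of the bin or touched by another
square. -/
def TouchesHorizontally (W : ℝ) (Q : List PlacedSquare) (q : PlacedSquare) : Prop :=
  W ≤ q.x + q.side ∨ q.x ≤ 0 ∨
    (∃ q' ∈ Q, q'.x ≤ q.x + q.side ∧ q.x + q.side < q'.x + q'.side ∧ q'.y < q.y + q.side ∧
      q.y < q'.y + q'.side) ∨
    ∃ q' ∈ Q, q.x ≤ q'.x + q'.side ∧ q'.x < q.x ∧ q'.y < q.y + q.side ∧ q.y < q'.y + q'.side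

/-- A packing of at most four squares with sides at least `4 * D` in the bin `[0, W] × [0, H]`, such
that each of the squares is touched both at a vertical and at a horizontal side. -/
structure TightPacking (W H D : ℝ) (Q : List PlacedSquare) : Prop where
  pos : 0 < D
  width : 4 * D ≤ W
  height : 4 * D ≤ H
  length : Q.length ≤ 4
  side : ∀ q ∈ Q, 4 * D ≤ q.side
  left : ∀ q ∈ Q, 0 ≤ q.x
  right : ∀ q ∈ Q, q.x + q.side ≤ W
  bottom : ∀ q ∈ Q, 0 ≤ q.y
  top : ∀ q ∈ Q, q.y + q.side ≤ H
  sep : ∀ q ∈ Q, ∀ q' ∈ Q, q ≠ q' → q.Avoids q'.x (q'.x + q'.side) q'.y (q'.y + q'.side)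
  horizontal : ∀ q ∈ Q, TouchesHorizontally W Q q
  vertical : ∀ q ∈ Q, TouchesHorizontally H (Q.map PlacedSquare.transpose) q.transpose

theorem TightPacking.transpose {W H D : ℝ} {Q : List PlacedSquare} (h : TightPacking W H D Q) :
    TightPacking H W D (Q.map PlacedSquare.transpose) where
  pos := h.pos
  width := h.height
  height := h.width
  length := by simpa using h.length
  side := by simpa [PlacedSquare.transpose] using h.side
  left := by simpa [PlacedSquare.transpose] using h.bottom
  right := by simpa [PlacedSquare.transpose] using h.top
  bottom := by simpa [PlacedSquare.transpose] using h.left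
  top := by simpa [PlacedSquare.transpose] using h.right
  sep := by
    simp only [List.mem_map, forall_exists_index, and_imp, forall_apply_eq_imp_iff₂]
    intro q hq q' hq' hne
    exact PlacedSquare.avoids_transpose.2 (h.sep q hq q' hq' fun e => hne (by rw [e]))
  horizontal := by
    simpa only [List.mem_map, forall_exists_index, and_imp, forall_apply_eq_imp_iff₂] using h.vertical
  vertical := by
    simp only [List.mem_map, forall_exists_index, and_imp, forall_apply_eq_imp_iff₂]
    intro q hq
    rw [map_transpose_map_transpose]
    exact h.horizontal q hq

theorem TightPacking.vertical' {W H D : ℝ} {Q : List PlacedSquare} (h : TightPacking W H D Q)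
    {q : PlacedSquare} (hq : q ∈ Q) :
    H ≤ q.y + q.side ∨ q.y ≤ 0 ∨
    (∃ q' ∈ Q, q'.y ≤ q.y + q.side ∧ q.y + q.side < q'.y + q'.side ∧ q'.x < q.x + q.side ∧
      q.x < q'.x + q'.side) ∨
    ∃ q' ∈ Q, q.y ≤ q'.y + q'.side ∧ q'.y < q.y ∧ q'.x < q.x + q.side ∧ q.x < q'.x + q'.side := by
  simpa [TouchesHorizontally, PlacedSquare.transpose] using h.vertical q hq

/-- Every free rectangle with one side at least `D` has its other side at most `M`. -/
def ArmBound (W H : ℝ) (Q : List PlacedSquare) (D M : ℝ) : Prop :=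
  ∀ x₁ x₂ y₁ y₂, FreeRect W H Q x₁ x₂ y₁ y₂ →
    (D ≤ y₂ - y₁ → x₂ - x₁ ≤ M) ∧ (D ≤ x₂ - x₁ → y₂ - y₁ ≤ M)

theorem ArmBound.transpose {W H : ℝ} {Q : List PlacedSquare} {D M : ℝ}
    (h : ArmBound W H Q D M) : ArmBound H W (Q.map PlacedSquare.transpose) D M :=
  fun x₁ x₂ y₁ y₂ hfree => (h y₁ y₂ x₁ x₂ (freeRect_transpose.1 hfree)).symm

/-- In the pinwheel this identifies the four blocking squares as all the squares of the packing, so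
only they can obstruct a gap or provide a contact. -/
theorem list_subset_of_length_le_four {α : Type*} {Q : List α} (hQ : Q.length ≤ 4) {a b c d : α}
    (ha : a ∈ Q) (hb : b ∈ Q) (hc : c ∈ Q) (hd : d ∈ Q) (hab : a ≠ b) (hac : a ≠ c) (had : a ≠ d)
    (hbc : b ≠ c) (hbd : b ≠ d) (hcd : c ≠ d) {q : α} (hq : q ∈ Q) :
    q = a ∨ q = b ∨ q = c ∨ q = d := by
  have hsub : List.Subperm [a, b, c, d] Q := by
    refine List.subperm_of_subset (by simp [*]) ?_
    intro z hz
    simp only [List.mem_cons, List.not_mem_nil, or_false] at hz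
    rcases hz with rfl | rfl | rfl | rfl <;> assumption
  have hperm := hsub.perm_of_length_le (by simpa using hQ)
  simpa using hperm.symm.subset hq

/-! ### The pinwheel argument -/

section Pinwheel

variable {W H D M : ℝ} {Q : List PlacedSquare} {x₁ y₁ t : ℝ}

/-- In a pinwheel of four squares, the free square in the centre is not larger than the widest of
the gaps between the squares and around them. -/
theorem TightPacking.pinwheel (h : TightPacking W H D Q) (hM : ArmBound W H Q D M)
    (ht : 0 < t) (htD : t < D) {a b c d : PlacedSquare} (ha : a ∈ Q) (hb : b ∈ Q) (hc : c ∈ Q)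
    (hd : d ∈ Q) (ha₁ : x₁ - D < a.x + a.side) (ha₂ : a.x + a.side ≤ x₁) (ha₃ : a.y < y₁ + t)
    (hb₁ : x₁ + t ≤ b.x) (hb₂ : b.x < x₁ + t + D) (hb₃ : b.y < y₁ + t) (hb₄ : y₁ < b.y + b.side)
    (hc₁ : y₁ - D < c.y + c.side) (hc₂ : c.y + c.side ≤ y₁) (hc₃ : c.x < x₁ + t)
    (hc₄ : x₁ < c.x + c.side)
    (hd₁ : y₁ + t ≤ d.y) (hd₂ : d.y < y₁ + t + D) (hd₃ : d.x < x₁ + t) (hd₄ : x₁ < d.x + d.side)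
    (hup : y₁ + t + D ≤ a.y + a.side) : t ≤ M := by
  have hD := h.pos
  have sa := h.side a ha
  have sb := h.side b hb
  have sc := h.side c hc
  have sd := h.side d hd
  have hab : a ≠ b := by rintro rfl; linarith
  have hac : a ≠ c := by rintro rfl; linarith
  have had : a ≠ d := by rintro rfl; linarith
  have hbc : b ≠ c := by rintro rfl; linarith
  have hbd : b ≠ d := by rintro rfl; linarith
  have hcd : c ≠ d := by rintro rfl; linarith
  -- The overhang of `a` fixes the orientation of the pinwheel: `d` must lie to the right of `a`,
  -- hence `b` below `d`, hence `c` to the left of `b`, hence `a` above `c`. Each deduction uses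
  -- that sides are at least `4 * D`, while the blockers are within `D` of the central square.
  have ad : a.x + a.side ≤ d.x := by
    rcases h.sep a ha d hd had with e | e | e | e <;> linarith
  have bd : b.y + b.side ≤ d.y := by
    rcases h.sep b hb d hd hbd with e | e | e | e <;> linarith
  have bc : c.x + c.side ≤ b.x := by
    rcases h.sep b hb c hc hbc with e | e | e | e <;> linarith
  have ac : c.y + c.side ≤ a.y := by
    rcases h.sep a ha c hc hac with e | e | e | e <;> linarith
  have hall : ∀ {q}, q ∈ Q → q = a ∨ q = b ∨ q = c ∨ q = d := fun hq =>
    list_subset_of_length_le_four h.length ha hb hc hd hab hac had hbc hbd hcd hq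
  have hfree : ∀ {u₁ u₂ v₁ v₂ : ℝ}, 0 ≤ u₁ → u₂ ≤ W → 0 ≤ v₁ → v₂ ≤ H → a.Avoids u₁ u₂ v₁ v₂ →
      b.Avoids u₁ u₂ v₁ v₂ → c.Avoids u₁ u₂ v₁ v₂ → d.Avoids u₁ u₂ v₁ v₂ →
      FreeRect W H Q u₁ u₂ v₁ v₂ := by
    intro u₁ u₂ v₁ v₂ h₁ h₂ h₃ h₄ h₅ h₆ h₇ h₈
    refine ⟨h₁, h₂, h₃, h₄, fun q hq => ?_⟩
    rcases hall hq with rfl | rfl | rfl | rfl <;> assumption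
  have la := h.left a ha
  have lb := h.left b hb
  have lc := h.left c hc
  have ld := h.left d hd
  have ra := h.right a ha
  have rb := h.right b hb
  have rc := h.right c hc
  have rd := h.right d hd
  have ba := h.bottom a ha
  have bb := h.bottom b hb
  have bc' := h.bottom c hc
  have bd' := h.bottom d hd
  have ta := h.top a ha
  have tb := h.top b hb
  have tc := h.top c hc
  have td := h.top d hd
  -- Square `a` touches the top of the bin or rests on `c`, so all the vertical slack above `c`
  -- forms one gap, either below or above `a`, that is at least `D` long. The other three squares
  -- are treated alike, going round the pinwheel.
  have ea : H - a.side - (c.y + c.side) ≤ M := by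
    have key : H ≤ a.y + a.side ∨ a.y ≤ c.y + c.side := by
      rcases h.vertical' ha with e | e | ⟨q, hq, e₁, e₂, e₃, e₄⟩ | ⟨q, hq, e₁, e₂, e₃, e₄⟩
      · exact Or.inl e
      · linarith
      · rcases hall hq with rfl | rfl | rfl | rfl <;> linarith
      · rcases hall hq with rfl | rfl | rfl | rfl
        · linarith
        · linarith
        · exact Or.inr e₁
        · linarith
    rcases key with e | e
    · have hlen : D ≤ a.x + a.side - max a.x c.x := by
        rcases max_cases a.x c.x with ⟨m, _⟩ | ⟨m, _⟩ <;> rw [m] <;> linarith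
      have := (hM (max a.x c.x) (a.x + a.side) (c.y + c.side) a.y
        (hfree (le_max_of_le_left la) ra (by linarith) (by linarith)
          (Or.inr (Or.inr (Or.inl le_rfl))) (Or.inl (by linarith))
          (Or.inr (Or.inr (Or.inr le_rfl))) (Or.inl ad))).2 hlen
      linarith
    · have := (hM a.x (a.x + a.side) (a.y + a.side) H
        (hfree la ra (by linarith) le_rfl
          (Or.inr (Or.inr (Or.inr le_rfl))) (Or.inl (by linarith))
          (Or.inr (Or.inr (Or.inr (by linarith)))) (Or.inl ad))).2 (by linarith)
      linarith
  have ed : W - d.side - (a.x + a.side) ≤ M := by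
    have key : W ≤ d.x + d.side ∨ d.x ≤ a.x + a.side := by
      rcases h.horizontal d hd with e | e | ⟨q, hq, e₁, e₂, e₃, e₄⟩ | ⟨q, hq, e₁, e₂, e₃, e₄⟩
      · exact Or.inl e
      · linarith
      · rcases hall hq with rfl | rfl | rfl | rfl <;> linarith
      · rcases hall hq with rfl | rfl | rfl | rfl
        · exact Or.inr e₁
        · linarith
        · linarith
        · linarith
    rcases key with e | e
    · have hlen : D ≤ min (a.y + a.side) (d.y + d.side) - d.y := by
        rcases min_cases (a.y + a.side) (d.y + d.side) with ⟨m, _⟩ | ⟨m, _⟩ <;> rw [m] <;> linarith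
      have := (hM (a.x + a.side) d.x d.y (min (a.y + a.side) (d.y + d.side))
        (hfree (by linarith) (by linarith) (by linarith) (min_le_of_left_le ta)
          (Or.inr (Or.inl le_rfl)) (Or.inr (Or.inr (Or.inr bd)))
          (Or.inr (Or.inr (Or.inr (by linarith)))) (Or.inl le_rfl))).1 hlen
      linarith
    · have := (hM (d.x + d.side) W d.y (d.y + d.side)
        (hfree (by linarith) le_rfl (by linarith) td
          (Or.inr (Or.inl (by linarith))) (Or.inr (Or.inr (Or.inr bd)))
          (Or.inr (Or.inr (Or.inr (by linarith)))) (Or.inr (Or.inl le_rfl)))).1 (by linarith)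
      linarith
  have eb : d.y - b.side ≤ M := by
    have key : b.y ≤ 0 ∨ d.y ≤ b.y + b.side := by
      rcases h.vertical' hb with e | e | ⟨q, hq, e₁, e₂, e₃, e₄⟩ | ⟨q, hq, e₁, e₂, e₃, e₄⟩
      · linarith
      · exact Or.inl e
      · rcases hall hq with rfl | rfl | rfl | rfl
        · linarith
        · linarith
        · linarith
        · exact Or.inr e₁
      · rcases hall hq with rfl | rfl | rfl | rfl <;> linarith
    rcases key with e | e
    · have hlen : D ≤ min (b.x + b.side) (d.x + d.side) - b.x := by
        rcases min_cases (b.x + b.side) (d.x + d.side) with ⟨m, _⟩ | ⟨m, _⟩ <;> rw [m] <;> linarith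
      have := (hM b.x (min (b.x + b.side) (d.x + d.side)) (b.y + b.side) d.y
        (hfree lb (min_le_of_left_le rb) (by linarith) (by linarith)
          (Or.inr (Or.inl (by linarith))) (Or.inr (Or.inr (Or.inr le_rfl)))
          (Or.inr (Or.inl bc)) (Or.inr (Or.inr (Or.inl le_rfl))))).2 hlen
      linarith
    · have := (hM b.x (b.x + b.side) 0 b.y
        (hfree lb rb le_rfl (by linarith)
          (Or.inr (Or.inl (by linarith))) (Or.inr (Or.inr (Or.inl le_rfl)))
          (Or.inr (Or.inl bc)) (Or.inr (Or.inr (Or.inl (by linarith)))))).2 (by linarith)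
      linarith
  have ec : b.x - c.side ≤ M := by
    have key : c.x ≤ 0 ∨ b.x ≤ c.x + c.side := by
      rcases h.horizontal c hc with e | e | ⟨q, hq, e₁, e₂, e₃, e₄⟩ | ⟨q, hq, e₁, e₂, e₃, e₄⟩
      · linarith
      · exact Or.inl e
      · rcases hall hq with rfl | rfl | rfl | rfl
        · linarith
        · exact Or.inr e₁
        · linarith
        · linarith
      · rcases hall hq with rfl | rfl | rfl | rfl <;> linarith
    rcases key with e | e
    · have hlen : D ≤ c.y + c.side - max b.y c.y := by
        rcases max_cases b.y c.y with ⟨m, _⟩ | ⟨m, _⟩ <;> rw [m] <;> linarith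
      have := (hM (c.x + c.side) b.x (max b.y c.y) (c.y + c.side)
        (hfree (by linarith) (by linarith) (le_max_of_le_left bb) tc
          (Or.inr (Or.inr (Or.inl ac))) (Or.inl le_rfl)
          (Or.inr (Or.inl le_rfl)) (Or.inr (Or.inr (Or.inl (by linarith)))))).1 hlen
      linarith
    · have := (hM 0 c.x c.y (c.y + c.side)
        (hfree le_rfl (by linarith) bc' tc
          (Or.inr (Or.inr (Or.inl ac))) (Or.inl (by linarith))
          (Or.inl le_rfl) (Or.inr (Or.inr (Or.inl (by linarith)))))).1 (by linarith)
      linarith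
  -- Since `a.side + b.side + t ≤ W` and `c.side + d.side + t ≤ H`, and the distances from `a` to
  -- `b` and from `c` to `d` are at least `t`, the four left-hand sides sum to at least `4 * t`.
  linarith

/-- What keeps a free square from being moved to the left by `D`. -/
theorem FreeRect.blocked_left
    (hI : FreeRect W H Q x₁ (x₁ + t) y₁ (y₁ + t))
    (hn : ¬ FreeRect W H Q (x₁ - D) (x₁ + t) y₁ (y₁ + t)) :
    x₁ < D ∨ ∃ q ∈ Q, x₁ - D < q.x + q.side ∧ q.x + q.side ≤ x₁ ∧ q.y < y₁ + t ∧
      y₁ < q.y + q.side := by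
  by_contra! hcon
  refine hn ⟨by linarith [hcon.1], hI.right, hI.bottom, hI.top, fun q hq => ?_⟩
  have hc := hcon.2 q hq
  rcases hI.avoids q hq with e | e | e | e
  · exact Or.inl e
  · by_contra! hna
    simp only [PlacedSquare.Avoids, not_or, not_le] at hna
    linarith [hc hna.2.1 e hna.2.2.1]
  · exact Or.inr (Or.inr (Or.inl e))
  · exact Or.inr (Or.inr (Or.inr e))

/-- What keeps a free square from being moved to the right by `D`. -/
theorem FreeRect.blocked_right
    (hI : FreeRect W H Q x₁ (x₁ + t) y₁ (y₁ + t))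
    (hn : ¬ FreeRect W H Q x₁ (x₁ + t + D) y₁ (y₁ + t)) :
    W < x₁ + t + D ∨ ∃ q ∈ Q, x₁ + t ≤ q.x ∧ q.x < x₁ + t + D ∧ q.y < y₁ + t ∧
      y₁ < q.y + q.side := by
  by_contra! hcon
  refine hn ⟨hI.left, hcon.1, hI.bottom, hI.top, fun q hq => ?_⟩
  have hc := hcon.2 q hq
  rcases hI.avoids q hq with e | e | e | e
  · by_contra! hna
    simp only [PlacedSquare.Avoids, not_or, not_le] at hna
    linarith [hc e hna.1 hna.2.2.1]
  · exact Or.inr (Or.inl e)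
  · exact Or.inr (Or.inr (Or.inl e))
  · exact Or.inr (Or.inr (Or.inr e))

/-- A free square that is blocked in the other three directions is not close to the left side of the
bin. -/
theorem TightPacking.not_near_left (h : TightPacking W H D Q) (ht : 0 < t) (htD : t < D)
    (hR : W < x₁ + t + D ∨ ∃ q ∈ Q, x₁ + t ≤ q.x ∧ q.x < x₁ + t + D ∧ q.y < y₁ + t ∧
      y₁ < q.y + q.side)
    (hB : y₁ < D ∨ ∃ q ∈ Q, y₁ - D < q.y + q.side ∧ q.y + q.side ≤ y₁ ∧ q.x < x₁ + t ∧
      x₁ < q.x + q.side)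
    (hT : H < y₁ + t + D ∨ ∃ q ∈ Q, y₁ + t ≤ q.y ∧ q.y < y₁ + t + D ∧ q.x < x₁ + t ∧
      x₁ < q.x + q.side) : ¬ x₁ < D := by
  intro hx
  have hW := h.width
  rcases hR with hR | ⟨b, hb, hb₁, hb₂, hb₃, hb₄⟩
  · linarith
  have sb := h.side b hb
  -- Near the left side of the bin, a blocker above has side at least `4 * D` and so reaches over
  -- `b`; thus `b` must end below it. With the same argument from below, `b.side < t + 2 * D < 3 *
  -- D`, which is too small.
  have h₁ : b.y + b.side < y₁ + t + D := by
    rcases hT with hT | ⟨d, hd, hd₁, hd₂, hd₃, hd₄⟩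
    · linarith [h.top b hb]
    · have hne : b ≠ d := by rintro rfl; linarith
      have sd := h.side d hd
      have ld := h.left d hd
      rcases h.sep b hb d hd hne with e | e | e | e <;> linarith
  have h₂ : y₁ - D < b.y := by
    rcases hB with hB | ⟨c, hc, hc₁, hc₂, hc₃, hc₄⟩
    · linarith [h.bottom b hb]
    · have hne : b ≠ c := by rintro rfl; linarith
      have sc := h.side c hc
      have lc := h.left c hc
      rcases h.sep b hb c hc hne with e | e | e | e <;> linarith
  linarith

/-- A free square that is blocked in the other three directions is not close to the right side of
the bin. -/
theorem TightPacking.not_near_right (h : TightPacking W H D Q) (ht : 0 < t) (htD : t < D)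
    (hL : x₁ < D ∨ ∃ q ∈ Q, x₁ - D < q.x + q.side ∧ q.x + q.side ≤ x₁ ∧ q.y < y₁ + t ∧
      y₁ < q.y + q.side)
    (hB : y₁ < D ∨ ∃ q ∈ Q, y₁ - D < q.y + q.side ∧ q.y + q.side ≤ y₁ ∧ q.x < x₁ + t ∧
      x₁ < q.x + q.side)
    (hT : H < y₁ + t + D ∨ ∃ q ∈ Q, y₁ + t ≤ q.y ∧ q.y < y₁ + t + D ∧ q.x < x₁ + t ∧
      x₁ < q.x + q.side) : ¬ W < x₁ + t + D := by
  intro hx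
  have hW := h.width
  rcases hL with hL | ⟨a, ha, ha₁, ha₂, ha₃, ha₄⟩
  · linarith
  have sa := h.side a ha
  have h₁ : a.y + a.side < y₁ + t + D := by
    rcases hT with hT | ⟨d, hd, hd₁, hd₂, hd₃, hd₄⟩
    · linarith [h.top a ha]
    · have hne : a ≠ d := by rintro rfl; linarith
      have sd := h.side d hd
      have rd := h.right d hd
      rcases h.sep a ha d hd hne with e | e | e | e <;> linarith
  have h₂ : y₁ - D < a.y := by
    rcases hB with hB | ⟨c, hc, hc₁, hc₂, hc₃, hc₄⟩
    · linarith [h.bottom a ha]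
    · have hne : a ≠ c := by rintro rfl; linarith
      have sc := h.side c hc
      have rc := h.right c hc
      rcases h.sep a ha c hc hne with e | e | e | e <;> linarith
  linarith

/-- No free square is wider than the widest long arm. -/
theorem TightPacking.squareBound (h : TightPacking W H D Q) (hM : ArmBound W H Q D M) :
    SquareBound (FreeRect W H Q) M := by
  intro x₁ y₁ t ht hI
  have hD := h.pos
  rcases le_or_gt D t with htD | htD
  · simpa using (hM _ _ _ _ hI).1 (by simpa using htD)
  by_contra hMt
  have hI' := hI.transpose
  have hh := h.transpose
  -- Extended by `D` in any direction, the square would become a long arm of width `t > M`.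
  have hL := hI.blocked_left (D := D) fun hf => hMt (by simpa using (hM _ _ _ _ hf).2 (by linarith))
  have hR := hI.blocked_right (D := D) fun hf => hMt (by simpa using (hM _ _ _ _ hf).2 (by linarith))
  have hB' := hI'.blocked_left (D := D) fun hf =>
    hMt (by simpa using (hM.transpose _ _ _ _ hf).2 (by linarith))
  have hT' := hI'.blocked_right (D := D) fun hf =>
    hMt (by simpa using (hM.transpose _ _ _ _ hf).2 (by linarith))
  have hB := hB'
  have hT := hT'
  simp only [List.mem_map, exists_exists_and_eq_and, PlacedSquare.transpose] at hB hT
  have nL := h.not_near_left ht htD hR hB hT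
  have nR := h.not_near_right ht htD hL hB hT
  have nB := hh.not_near_left ht htD hT' (by simpa [PlacedSquare.transpose] using hL)
    (by simpa [PlacedSquare.transpose] using hR)
  have nT := hh.not_near_right ht htD hB' (by simpa [PlacedSquare.transpose] using hL)
    (by simpa [PlacedSquare.transpose] using hR)
  obtain ⟨a, ha, ha₁, ha₂, ha₃, ha₄⟩ := hL.resolve_left nL
  obtain ⟨b, hb, hb₁, hb₂, hb₃, hb₄⟩ := hR.resolve_left nR
  obtain ⟨c, hc, hc₁, hc₂, hc₃, hc₄⟩ := hB.resolve_left nB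
  obtain ⟨d, hd, hd₁, hd₂, hd₃, hd₄⟩ := hT.resolve_left nT
  rcases le_or_gt (y₁ + t + D) (a.y + a.side) with hup | hup
  · exact hMt (h.pinwheel hM ht htD ha hb hc hd ha₁ ha₂ ha₃ hb₁ hb₂ hb₃ hb₄ hc₁ hc₂ hc₃ hc₄
      hd₁ hd₂ hd₃ hd₄ hup)
  -- If `a` does not reach far up, it reaches far down, which pushes `c` to the right: the pinwheel
  -- of the other orientation, its mirror image in the diagonal.
  · have sa := h.side a ha
    have sc := h.side c hc
    have hac : a ≠ c := by rintro rfl; linarith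
    have hright : x₁ + t + D ≤ c.x + c.side := by
      rcases h.sep a ha c hc hac with e | e | e | e <;> linarith
    exact hMt (hh.pinwheel hM.transpose ht htD (List.mem_map_of_mem hc) (List.mem_map_of_mem hd)
      (List.mem_map_of_mem ha) (List.mem_map_of_mem hb) hc₁ hc₂ hc₃ hd₁ hd₂ hd₃ hd₄ ha₁ ha₂ ha₃ ha₄
      hb₁ hb₂ hb₃ hb₄ hright)

end Pinwheel

/-! ### The grid of a packing and its widest long arm -/

section Grid

variable {W H D : ℝ} {Q : List PlacedSquare}

/-- The abscissae of the vertical sides of the bin and of the squares. -/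
noncomputable def gridLines (W : ℝ) (Q : List PlacedSquare) : Finset ℝ :=
  insert 0 (insert W ((Q.map fun q => q.x).toFinset ∪ (Q.map fun q => q.x + q.side).toFinset))

theorem card_gridLines_le (W : ℝ) (Q : List PlacedSquare) :
    (gridLines W Q).card ≤ 2 * Q.length + 2 := by
  have h₁ := List.toFinset_card_le (Q.map fun q => q.x)
  have h₂ := List.toFinset_card_le (Q.map fun q => q.x + q.side)
  rw [List.length_map] at h₁ h₂
  have h₃ := Finset.card_union_le (Q.map fun q => q.x).toFinset
    (Q.map fun q => q.x + q.side).toFinset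
  have h₄ := Finset.card_insert_le W
    ((Q.map fun q => q.x).toFinset ∪ (Q.map fun q => q.x + q.side).toFinset)
  have h₅ := Finset.card_insert_le 0 (insert W
    ((Q.map fun q => q.x).toFinset ∪ (Q.map fun q => q.x + q.side).toFinset))
  unfold gridLines
  omega

theorem exists_greatest_le {X : Finset ℝ} {z u : ℝ} (hz : z ∈ X) (hzu : z ≤ u) :
    ∃ a ∈ X, a ≤ u ∧ ∀ x ∈ X, x ≤ u → x ≤ a := by
  obtain ⟨a, ha, hmax⟩ := (X.filter (· ≤ u)).exists_max_image id ⟨z, by simp [hz, hzu]⟩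
  simp only [Finset.mem_filter, id] at ha hmax
  exact ⟨a, ha.1, ha.2, fun x hx hxu => hmax x ⟨hx, hxu⟩⟩

theorem exists_least_ge {X : Finset ℝ} {z u : ℝ} (hz : z ∈ X) (huz : u ≤ z) :
    ∃ b ∈ X, u ≤ b ∧ ∀ x ∈ X, u ≤ x → b ≤ x := by
  obtain ⟨b, hb, hmin⟩ := (X.filter (u ≤ ·)).exists_min_image id ⟨z, by simp [hz, huz]⟩
  simp only [Finset.mem_filter, id] at hb hmin
  exact ⟨b, hb.1, hb.2, fun x hx hxu => hmin x ⟨hx, hxu⟩⟩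

/-- Between the rectangle and the nearest grid lines to its left and right there is no vertical side
of a square, so widening meets no obstacle. -/
theorem FreeRect.hull {x₁ x₂ y₁ y₂ : ℝ} (h : FreeRect W H Q x₁ x₂ y₁ y₂) :
    ∃ a ∈ gridLines W Q, ∃ b ∈ gridLines W Q, a ≤ x₁ ∧ x₂ ≤ b ∧ FreeRect W H Q a b y₁ y₂ := by
  have h₀ : (0 : ℝ) ∈ gridLines W Q := by simp [gridLines]
  have hW : W ∈ gridLines W Q := by simp [gridLines]
  obtain ⟨a, ha, hax, hamax⟩ := exists_greatest_le h₀ h.left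
  obtain ⟨b, hb, hxb, hbmin⟩ := exists_least_ge hW h.right
  refine ⟨a, ha, b, hb, hax, hxb, hamax 0 h₀ h.left, hbmin W hW h.right, h.bottom, h.top,
    fun q hq => ?_⟩
  have hq₁ : q.x ∈ gridLines W Q := by
    simp only [gridLines, Finset.mem_insert, Finset.mem_union, List.mem_toFinset, List.mem_map]
    exact Or.inr (Or.inr (Or.inl ⟨q, hq, rfl⟩))
  have hq₂ : q.x + q.side ∈ gridLines W Q := by
    simp only [gridLines, Finset.mem_insert, Finset.mem_union, List.mem_toFinset, List.mem_map]
    exact Or.inr (Or.inr (Or.inr ⟨q, hq, rfl⟩))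
  rcases h.avoids q hq with e | e | e | e
  · exact Or.inl (hbmin _ hq₁ e)
  · exact Or.inr (Or.inl (hamax _ hq₂ e))
  · exact Or.inr (Or.inr (Or.inl e))
  · exact Or.inr (Or.inr (Or.inr e))

/-- A square cannot be to the right of one rectangle and to the left of the other when their
horizontal ranges overlap. -/
theorem FreeRect.merge {x₁ x₂ x₁' x₂' y₁ y₂ : ℝ} (hQ : ∀ q ∈ Q, 0 ≤ q.side)
    (h : FreeRect W H Q x₁ x₂ y₁ y₂) (h' : FreeRect W H Q x₁' x₂' y₁ y₂) (h₁ : x₁ < x₂')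
    (h₂ : x₁' < x₂) : FreeRect W H Q (min x₁ x₁') (max x₂ x₂') y₁ y₂ := by
  refine ⟨le_min h.left h'.left, max_le h.right h'.right, h.bottom, h.top, fun q hq => ?_⟩
  have hq₀ := hQ q hq
  rcases h.avoids q hq with e | e | e | e
  · rcases h'.avoids q hq with e' | e' | e' | e'
    · exact Or.inl (max_le e e')
    · linarith
    · exact Or.inr (Or.inr (Or.inl e'))
    · exact Or.inr (Or.inr (Or.inr e'))
  · rcases h'.avoids q hq with e' | e' | e' | e'
    · linarith
    · exact Or.inr (Or.inl (le_min e e'))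
    · exact Or.inr (Or.inr (Or.inl e'))
    · exact Or.inr (Or.inr (Or.inr e'))
  · exact Or.inr (Or.inr (Or.inl e))
  · exact Or.inr (Or.inr (Or.inr e))

theorem FreeRect.mono {x₁ x₂ y₁ y₂ x₁' x₂' y₁' y₂' : ℝ} (h : FreeRect W H Q x₁ x₂ y₁ y₂)
    (h₁ : x₁ ≤ x₁') (h₂ : x₂' ≤ x₂) (h₃ : y₁ ≤ y₁') (h₄ : y₂' ≤ y₂) :
    FreeRect W H Q x₁' x₂' y₁' y₂' := by
  refine ⟨h.left.trans h₁, h₂.trans h.right, h.bottom.trans h₃, h₄.trans h.top, fun q hq => ?_⟩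
  rcases h.avoids q hq with e | e | e | e
  · exact Or.inl (h₂.trans e)
  · exact Or.inr (Or.inl (e.trans h₁))
  · exact Or.inr (Or.inr (Or.inl (h₄.trans e)))
  · exact Or.inr (Or.inr (Or.inr (e.trans h₃)))

theorem gridRegion_freeRect (hQ : ∀ q ∈ Q, 0 ≤ q.side) :
    GridRegion (FreeRect W H Q) (gridLines W Q)
      (gridLines H (Q.map PlacedSquare.transpose)) where
  mono h h₁ h₂ h₃ h₄ := h.mono h₁ h₂ h₃ h₄
  merge_left h h' h₁ h₂ := h.merge hQ h' h₁ h₂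
  merge_right h h' h₁ h₂ := freeRect_transpose.1
    (h.transpose.merge (by simpa [PlacedSquare.transpose] using hQ) h'.transpose h₁ h₂)
  hull_left h := h.hull
  hull_right h := by
    obtain ⟨a, ha, b, hb, h₁, h₂, h₃⟩ := h.transpose.hull
    exact ⟨a, ha, b, hb, h₁, h₂, freeRect_transpose.1 h₃⟩

/-- Among the vertical arms of length at least `D` there is a widest one. -/
theorem GridRegion.exists_widest_arm {F : ℝ → ℝ → ℝ → ℝ → Prop} {X Y : Finset ℝ}
    (hF : GridRegion F X Y) {x₁ x₂ y₁ y₂ : ℝ} (h : F x₁ x₂ y₁ y₂) (hD : D ≤ y₂ - y₁) :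
    ∃ x y m, F x (x + m) y (y + D) ∧
      ∀ x₁ x₂ y₁ y₂, F x₁ x₂ y₁ y₂ → D ≤ y₂ - y₁ → x₂ - x₁ ≤ m := by
  classical
  -- Every long arm widens to one bounded by grid lines, which leaves finitely many widths to
  -- maximise over.
  have hgrid : ∀ x₁ x₂ y₁ y₂, F x₁ x₂ y₁ y₂ → D ≤ y₂ - y₁ →
      ∃ z ∈ (X ×ˢ X).filter fun z => ∃ y, F z.1 z.2 y (y + D), x₂ - x₁ ≤ z.2 - z.1 := by
    intro x₁ x₂ y₁ y₂ h hD
    obtain ⟨a, ha, b, hb, h₁, h₂, hab⟩ := hF.hull_left h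
    refine ⟨(a, b), Finset.mem_filter.2 ⟨Finset.mem_product.2 ⟨ha, hb⟩, y₁, ?_⟩, by simp; linarith⟩
    exact hF.mono hab le_rfl le_rfl le_rfl (by linarith)
  obtain ⟨z₀, hz₀, -⟩ := hgrid _ _ _ _ h hD
  obtain ⟨z, hz, hmax⟩ := Finset.exists_max_image _ (fun z : ℝ × ℝ => z.2 - z.1) ⟨z₀, hz₀⟩
  obtain ⟨y, hy⟩ := (Finset.mem_filter.1 hz).2
  refine ⟨z.1, y, z.2 - z.1, by simpa using hy, fun x₁ x₂ y₁ y₂ h hD => ?_⟩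
  obtain ⟨w, hw, hle⟩ := hgrid _ _ _ _ h hD
  exact hle.trans (hmax w hw)

/-- If there is a free square, then there is a widest long arm. -/
theorem TightPacking.exists_armBound (h : TightPacking W H D Q) {x y t : ℝ} (ht : 0 < t)
    (hfree : FreeRect W H Q x (x + t) y (y + t)) :
    ∃ M, ArmBound W H Q D M ∧ ((∃ x y, FreeRect W H Q x (x + M) y (y + D)) ∨
      ∃ x y, FreeRect W H Q x (x + D) y (y + M)) := by
  have hF : GridRegion (FreeRect W H Q) (gridLines W Q) (gridLines H (Q.map PlacedSquare.transpose)) :=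
    gridRegion_freeRect fun q hq => by linarith [h.side q hq, h.pos]
  by_cases hV : ∃ x₁ x₂ y₁ y₂, FreeRect W H Q x₁ x₂ y₁ y₂ ∧ D ≤ y₂ - y₁ <;>
    by_cases hH : ∃ x₁ x₂ y₁ y₂, FreeRect W H Q x₁ x₂ y₁ y₂ ∧ D ≤ x₂ - x₁
  · obtain ⟨x₁, x₂, y₁, y₂, hv, hvD⟩ := hV
    obtain ⟨x₁', x₂', y₁', y₂', hh, hhD⟩ := hH
    obtain ⟨x₀, y₀, m, h₁, h₂⟩ := hF.exists_widest_arm hv hvD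
    obtain ⟨y₀', x₀', m', h₁', h₂'⟩ := hF.swap.exists_widest_arm hh hhD
    rcases le_total m m' with hm | hm
    · exact ⟨m', fun a b c d hf => ⟨fun hd => (h₂ a b c d hf hd).trans hm, h₂' c d a b hf⟩,
        Or.inr ⟨x₀', y₀', h₁'⟩⟩
    · exact ⟨m, fun a b c d hf => ⟨h₂ a b c d hf, fun hd => (h₂' c d a b hf hd).trans hm⟩,
        Or.inl ⟨x₀, y₀, h₁⟩⟩
  · obtain ⟨x₁, x₂, y₁, y₂, hv, hvD⟩ := hV
    obtain ⟨x₀, y₀, m, h₁, h₂⟩ := hF.exists_widest_arm hv hvD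
    exact ⟨m, fun a b c d hf => ⟨h₂ a b c d hf, fun hd => (hH ⟨a, b, c, d, hf, hd⟩).elim⟩,
      Or.inl ⟨x₀, y₀, h₁⟩⟩
  · obtain ⟨x₁', x₂', y₁', y₂', hh, hhD⟩ := hH
    obtain ⟨y₀', x₀', m', h₁', h₂'⟩ := hF.swap.exists_widest_arm hh hhD
    exact ⟨m', fun a b c d hf => ⟨fun hd => (hV ⟨a, b, c, d, hf, hd⟩).elim, h₂' c d a b hf⟩,
      Or.inr ⟨x₀', y₀', h₁'⟩⟩
  -- Without any long arm the bound holds vacuously for `M = 0`, which would exclude every free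
  -- square.
  · exact absurd (h.squareBound (M := 0) (fun a b c d hf =>
      ⟨fun hd => (hV ⟨a, b, c, d, hf, hd⟩).elim, fun hd => (hH ⟨a, b, c, d, hf, hd⟩).elim⟩)
      x y t ht hfree) (not_le.2 ht)

end Grid

/-! ### Areas of disjoint rectangles -/

section Area

/-- Two nondegenerate open rectangles are disjoint iff a line parallel to an axis separates them. -/
theorem disjoint_openRect_iff {a b c d a' b' c' d' : ℝ} (h₁ : a < b) (h₂ : c < d) (h₁' : a' < b')
    (h₂' : c' < d') : Disjoint (Ioo a b ×ˢ Ioo c d) (Ioo a' b' ×ˢ Ioo c' d') ↔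
      b ≤ a' ∨ b' ≤ a ∨ d ≤ c' ∨ d' ≤ c := by
  rw [Set.disjoint_prod, Set.Ioo_disjoint_Ioo, Set.Ioo_disjoint_Ioo, min_le_iff, le_max_iff,
    le_max_iff, min_le_iff, le_max_iff, le_max_iff]
  constructor
  · rintro (((e | e) | (e | e)) | ((e | e) | (e | e)))
    all_goals first | linarith | tauto
  · tauto

theorem volume_openRect {a b c d : ℝ} (h₁ : a ≤ b) :
    MeasureTheory.volume (Ioo a b ×ˢ Ioo c d) = ENNReal.ofReal ((b - a) * (d - c)) := by
  rw [MeasureTheory.Measure.volume_eq_prod, MeasureTheory.Measure.prod_prod, Real.volume_Ioo,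
    Real.volume_Ioo, ENNReal.ofReal_mul (by linarith)]

theorem isOpen_iUnion_inner (Q : List PlacedSquare) : IsOpen (⋃ q ∈ Q, q.inner) :=
  isOpen_iUnion fun _ => isOpen_iUnion fun _ => isOpen_Ioo.prod isOpen_Ioo

theorem volume_iUnion_inner {Q : List PlacedSquare} (hQ : ∀ q ∈ Q, 0 ≤ q.side)
    (hd : Q.Pairwise fun q q' => Disjoint q.inner q'.inner) :
    MeasureTheory.volume (⋃ q ∈ Q, q.inner) = ENNReal.ofReal (Q.map PlacedSquare.area).sum := by
  induction Q with
  | nil => simp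
  | cons a Q ih =>
    rw [List.pairwise_cons] at hd
    have hsum : 0 ≤ (Q.map PlacedSquare.area).sum := by
      refine List.sum_nonneg fun z hz => ?_
      obtain ⟨q, -, rfl⟩ := List.mem_map.1 hz
      exact sq_nonneg _
    have hun : (⋃ q ∈ a :: Q, q.inner) = a.inner ∪ ⋃ q ∈ Q, q.inner := by
      simp only [List.mem_cons, iUnion_iUnion_eq_or_left]
    rw [hun, MeasureTheory.measure_union _ _, ih (fun q hq => hQ q (by simp [hq])) hd.2,
      PlacedSquare.inner, volume_openRect (by linarith [hQ a (by simp)]), List.map_cons,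
      List.sum_cons, ENNReal.ofReal_add (p := a.area) (sq_nonneg _) hsum, PlacedSquare.area]
    · congr 2
      ring
    · simp only [disjoint_iUnion_right]
      exact hd.1
    · exact (isOpen_iUnion_inner Q).measurableSet

/-- Applied to the widest arm, this turns the small uncovered area into a bound on `M`. -/
theorem FreeRect.area_le {W H : ℝ} {Q : List PlacedSquare} (hQ : ∀ q ∈ Q, 0 < q.side)
    (hin : ∀ q ∈ Q, 0 ≤ q.x ∧ q.x + q.side ≤ W ∧ 0 ≤ q.y ∧ q.y + q.side ≤ H)
    (hd : Q.Pairwise fun q q' => Disjoint q.inner q'.inner)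
    {x₁ x₂ y₁ y₂ : ℝ} (h : FreeRect W H Q x₁ x₂ y₁ y₂) (hx : x₁ < x₂) (hy : y₁ < y₂) :
    (x₂ - x₁) * (y₂ - y₁) + (Q.map PlacedSquare.area).sum ≤ W * H := by
  have hsum : 0 ≤ (Q.map PlacedSquare.area).sum := by
    refine List.sum_nonneg fun z hz => ?_
    obtain ⟨q, -, rfl⟩ := List.mem_map.1 hz
    exact sq_nonneg _
  have hsub : (Ioo x₁ x₂ ×ˢ Ioo y₁ y₂) ∪ ⋃ q ∈ Q, q.inner ⊆ Ioo 0 W ×ˢ Ioo 0 H := by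
    refine union_subset (prod_mono (Ioo_subset_Ioo h.left h.right) (Ioo_subset_Ioo h.bottom h.top))
      (iUnion₂_subset fun q hq => ?_)
    obtain ⟨e₁, e₂, e₃, e₄⟩ := hin q hq
    exact prod_mono (Ioo_subset_Ioo e₁ e₂) (Ioo_subset_Ioo e₃ e₄)
  have hle := MeasureTheory.measure_mono (μ := MeasureTheory.volume) hsub
  have hW : 0 ≤ W := by linarith [h.left, h.right]
  have hH : 0 ≤ H := by linarith [h.bottom, h.top]
  have hp : 0 ≤ (x₂ - x₁) * (y₂ - y₁) := mul_nonneg (by linarith) (by linarith)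
  rw [MeasureTheory.measure_union _ (isOpen_iUnion_inner Q).measurableSet, volume_iUnion_inner (fun q hq => (hQ q hq).le) hd,
    volume_openRect hx.le, volume_openRect hW, ← ENNReal.ofReal_add hp hsum,
    ENNReal.ofReal_le_ofReal_iff (by simpa using mul_nonneg hW hH)] at hle
  · simpa using hle
  · simp only [disjoint_iUnion_right]
    intro q hq
    have := hQ q hq
    exact (disjoint_openRect_iff hx hy (by linarith) (by linarith)).2 (h.avoids q hq)

end Area

/-! ### From right-angle vertices to contacts -/

section CornerPacking

/-- The point `(x, y)` is an uncovered point in the interior of the bin `[0, W] × [0, H]`. -/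
structure PointFree (W H : ℝ) (Q : List PlacedSquare) (x y : ℝ) : Prop where
  left : 0 < x
  right : x < W
  bottom : 0 < y
  top : y < H
  notMem : ∀ q ∈ Q, q.x ≤ x → x ≤ q.x + q.side → q.y ≤ y → ¬ y ≤ q.y + q.side

theorem mem_freeSpace_iff {h : ℝ} {Q : List PlacedSquare} {p : ℝ × ℝ} :
    p ∈ freeSpace h Q ↔ PointFree 1 h Q p.1 p.2 := by
  simp only [freeSpace, PlacedSquare.closed, Set.mem_sdiff, mem_prod, mem_Ioo, mem_iUnion, mem_Icc,
    exists_prop, not_exists, not_and]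
  constructor
  · rintro ⟨⟨⟨h₁, h₂⟩, h₃, h₄⟩, h₅⟩
    exact ⟨h₁, h₂, h₃, h₄, fun q hq e₁ e₂ => h₅ q hq ⟨e₁, e₂⟩⟩
  · rintro ⟨h₁, h₂, h₃, h₄, h₅⟩
    exact ⟨⟨⟨h₁, h₂⟩, h₃, h₄⟩, fun q hq e => h₅ q hq e.1 e.2⟩

theorem PointFree.transpose {W H : ℝ} {Q : List PlacedSquare} {x y : ℝ}
    (h : PointFree H W (Q.map PlacedSquare.transpose) y x) : PointFree W H Q x y :=
  ⟨h.bottom, h.top, h.left, h.right, fun q hq h₁ h₂ h₃ h₄ =>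
    h.notMem q.transpose (List.mem_map_of_mem hq) h₃ h₄ h₁ h₂⟩

theorem eventually_forall_mem_list {α β : Type*} {l : Filter α} (Q : List β) {p : α → β → Prop}
    (h : ∀ q ∈ Q, ∀ᶠ s in l, p s q) : ∀ᶠ s in l, ∀ q ∈ Q, p s q := by
  have := (Filter.eventually_all_finite (List.finite_toSet Q)).2 h
  exact this

/-- If points arbitrarily close to a vertical side of `q` are not free, then `q` is touched. -/
theorem touchesHorizontally_of_eventually {W H α v : ℝ} {Q : List PlacedSquare} {q : PlacedSquare}
    {f : ℝ → ℝ} (hb : 0 ≤ q.y) (ht : q.y + q.side ≤ H)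
    (hv : (α = 1 ∧ v = q.x) ∨ (α = -1 ∧ v = q.x + q.side))
    (hf : ∀ᶠ s in 𝓝[>] (0 : ℝ), q.y < f s ∧ f s < q.y + q.side)
    (hn : ∀ᶠ s in 𝓝[>] (0 : ℝ), ¬ PointFree W H Q (v - α * s) (f s)) :
    TouchesHorizontally W Q q := by
  by_contra hcon
  simp only [TouchesHorizontally, not_or, not_le, not_exists, not_and] at hcon
  obtain ⟨c₁, c₂, c₃, c₄⟩ := hcon
  have hs : ∀ δ : ℝ, 0 < δ → ∀ᶠ s in 𝓝[>] (0 : ℝ), s < δ := fun δ hδ =>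
    (eventually_lt_nhds hδ).filter_mono nhdsWithin_le_nhds
  have hs₀ : ∀ᶠ s in 𝓝[>] (0 : ℝ), 0 < s := self_mem_nhdsWithin
  rcases hv with ⟨rfl, rfl⟩ | ⟨rfl, rfl⟩
  -- The list is finite, so for small `s` every square strictly to the left of `q` stays to the left
  -- of the test point. A square that still covers the point would be a contact.
  · have hQ := eventually_forall_mem_list (l := 𝓝[>] (0 : ℝ)) Q
      (p := fun s q' => q'.x + q'.side < q.x → q'.x + q'.side < q.x - s) (fun q' _ => by
        by_cases hq : q'.x + q'.side < q.x
        · filter_upwards [hs (q.x - (q'.x + q'.side)) (by linarith)] with s hs _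
          linarith
        · exact Eventually.of_forall fun s h => (hq h).elim)
    obtain ⟨s, e₁, e₂, e₃, e₄, e₅⟩ :=
      (hf.and (hn.and (hQ.and (hs₀.and (hs q.x c₂))))).exists
    refine e₂ ⟨by linarith, by linarith, by linarith, by linarith, fun q' hq' k₁ k₂ k₃ k₄ => ?_⟩
    rcases lt_or_ge (q'.x + q'.side) q.x with hlt | hge
    · linarith [e₃ q' hq' hlt]
    · exact c₄ q' hq' hge (by linarith) (by linarith) (by linarith)
  · have hQ := eventually_forall_mem_list (l := 𝓝[>] (0 : ℝ)) Q
      (p := fun s q' => q.x + q.side < q'.x → q.x + q.side + s < q'.x) (fun q' _ => by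
        by_cases hq : q.x + q.side < q'.x
        · filter_upwards [hs (q'.x - (q.x + q.side)) (by linarith)] with s hs _
          linarith
        · exact Eventually.of_forall fun s h => (hq h).elim)
    obtain ⟨s, e₁, e₂, e₃, e₄, e₅⟩ :=
      (hf.and (hn.and (hQ.and (hs₀.and (hs (W - (q.x + q.side)) (by linarith)))))).exists
    refine e₂ ⟨by linarith, by linarith, by linarith, by linarith, fun q' hq' k₁ k₂ k₃ k₄ => ?_⟩
    rcases lt_or_ge (q.x + q.side) q'.x with hlt | hge
    · linarith [e₃ q' hq' hlt]
    · exact c₃ q' hq' hge (by linarith) (by linarith) (by linarith)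

/-- An open rectangle is uncovered iff it lies in the bin and avoids all squares. -/
theorem openRect_subset_freeSpace_iff {h : ℝ} {Q : List PlacedSquare} (hQ : ∀ q ∈ Q, 0 < q.side)
    {x₁ x₂ y₁ y₂ : ℝ} (hx : x₁ < x₂) (hy : y₁ < y₂) :
    Ioo x₁ x₂ ×ˢ Ioo y₁ y₂ ⊆ freeSpace h Q ↔ FreeRect 1 h Q x₁ x₂ y₁ y₂ := by
  constructor
  · intro hsub
    have hbin : Ioo x₁ x₂ ×ˢ Ioo y₁ y₂ ⊆ Ioo (0 : ℝ) 1 ×ˢ Ioo 0 h := fun p hp => (hsub hp).1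
    replace hbin := (Set.prod_subset_prod_iff.1 hbin).resolve_right
      (not_or.2 ⟨(nonempty_Ioo.2 hx).ne_empty, (nonempty_Ioo.2 hy).ne_empty⟩)
    rw [Ioo_subset_Ioo_iff hx, Ioo_subset_Ioo_iff hy] at hbin
    refine ⟨hbin.1.1, hbin.1.2, hbin.2.1, hbin.2.2, fun q hq => ?_⟩
    have hq₀ := hQ q hq
    refine (disjoint_openRect_iff hx hy (by linarith) (by linarith)).1 ?_
    rw [Set.disjoint_left]
    intro p hp hpq
    refine (hsub hp).2 (mem_iUnion₂.2 ⟨q, hq, ?_⟩)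
    exact prod_mono Ioo_subset_Icc_self Ioo_subset_Icc_self hpq
  · rintro hf ⟨x, y⟩ ⟨⟨h₁, h₂⟩, h₃, h₄⟩
    refine mem_freeSpace_iff.2 ⟨hf.left.trans_lt h₁, h₂.trans_le hf.right, hf.bottom.trans_lt h₃,
      h₄.trans_le hf.top, fun q hq k₁ k₂ k₃ k₄ => ?_⟩
    rcases hf.avoids q hq with e | e | e | e <;> simp only at * <;> linarith

/-- A square that is packed at a right-angle vertex is touched at a vertical and at a horizontal
side. -/
theorem touches_of_isRightAngleVertex {h : ℝ} {Q : List PlacedSquare} {q : PlacedSquare}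
    (hQ : ∀ q ∈ Q, 0 < q.side) (hpos : 0 < q.side) (hfree : q.inner ⊆ freeSpace h Q)
    {v : ℝ × ℝ} (hv : v ∈ q.corners) (hR : IsRightAngleVertex (freeSpace h Q) v) :
    TouchesHorizontally 1 Q q ∧
      TouchesHorizontally h (Q.map PlacedSquare.transpose) q.transpose := by
  have hrect := (openRect_subset_freeSpace_iff hQ (by linarith) (by linarith)).1 hfree
  obtain ⟨vx, vy⟩ := v
  obtain ⟨α, hα, hαv⟩ : ∃ α : ℝ, (α = 1 ∨ α = -1) ∧
      ((α = 1 ∧ vx = q.x) ∨ (α = -1 ∧ vx = q.x + q.side)) := by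
    rcases hv.1 with e | e
    · exact ⟨1, Or.inl rfl, Or.inl ⟨rfl, e⟩⟩
    · exact ⟨-1, Or.inr rfl, Or.inr ⟨rfl, e⟩⟩
  obtain ⟨β, hβ, hβv⟩ : ∃ β : ℝ, (β = 1 ∨ β = -1) ∧
      ((β = 1 ∧ vy = q.y) ∨ (β = -1 ∧ vy = q.y + q.side)) := by
    rcases hv.2 with e | e
    · exact ⟨1, Or.inl rfl, Or.inl ⟨rfl, e⟩⟩
    · exact ⟨-1, Or.inr rfl, Or.inr ⟨rfl, e⟩⟩
  obtain ⟨σ, τ, hσ, hτ, hev⟩ := hR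
  have hs₀ : ∀ᶠ s in 𝓝[>] (0 : ℝ), 0 < s := self_mem_nhdsWithin
  have hs₁ : ∀ᶠ s in 𝓝[>] (0 : ℝ), s < q.side :=
    (eventually_lt_nhds hpos).filter_mono nhdsWithin_le_nhds
  have htend : ∀ a b : ℝ, Tendsto (fun s : ℝ => (vx + a * s, vy + b * s)) (𝓝[>] 0) (𝓝 (vx, vy)) := by
    intro a b
    have hc : Continuous fun s : ℝ => (vx + a * s, vy + b * s) := by fun_prop
    have := hc.tendsto 0
    simp only [mul_zero, add_zero] at this
    exact this.mono_left nhdsWithin_le_nhds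
  have hside : ∀ {w y : ℝ} {γ s : ℝ}, ((γ = 1 ∧ w = y) ∨ (γ = -1 ∧ w = y + q.side)) → 0 < s →
      s < q.side → y < w + γ * s ∧ w + γ * s < y + q.side := by
    rintro w y γ s (⟨rfl, rfl⟩ | ⟨rfl, rfl⟩) h₁ h₂ <;> constructor <;> linarith
  have hdiag : ∀ᶠ s in 𝓝[>] (0 : ℝ), (vx + α * s, vy + β * s) ∈ freeSpace h Q := by
    filter_upwards [hs₀, hs₁] with s h₁ h₂
    exact hfree ⟨hside hαv h₁ h₂, hside hβv h₁ h₂⟩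
  -- The quadrant filled by `q` is free near `v`, so it is the quadrant of the right angle or its
  -- opposite. Both have the same two neighbours, and these are not free.
  have hadj : ∀ᶠ s in 𝓝[>] (0 : ℝ), (vx - α * s, vy + β * s) ∉ freeSpace h Q ∧
      (vx + α * s, vy - β * s) ∉ freeSpace h Q := by
    filter_upwards [hs₀, hdiag, (htend α β).eventually hev, (htend (-α) β).eventually hev,
      (htend α (-β)).eventually hev] with s h₁ h₂ k₁ k₂ k₃
    simp only [quadrant, mem_ofPred_eq, add_sub_cancel_left, neg_mul, ← sub_eq_add_neg,
      sub_sub_cancel_left] at k₁ k₂ k₃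
    rcases hα with rfl | rfl <;> rcases hβ with rfl | rfl <;> rcases hσ with rfl | rfl <;>
      rcases hτ with rfl | rfl <;> norm_num [h₁] at k₁ k₂ k₃ h₂ ⊢ <;> tauto
  constructor
  · refine touchesHorizontally_of_eventually (f := fun s => vy + β * s)
      hrect.bottom hrect.top hαv ?_ ?_
    · filter_upwards [hs₀, hs₁] with s h₁ h₂
      exact hside hβv h₁ h₂
    · filter_upwards [hadj] with s hs hp
      exact hs.1 (mem_freeSpace_iff.2 hp)
  · refine touchesHorizontally_of_eventually (q := q.transpose) (f := fun s => vx + α * s)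
      hrect.left hrect.right hβv ?_ ?_
    · filter_upwards [hs₀, hs₁] with s h₁ h₂
      exact hside hαv h₁ h₂
    · filter_upwards [hadj] with s hs hp
      exact hs.2 (mem_freeSpace_iff.2 hp.transpose)

theorem TouchesHorizontally.mono {W : ℝ} {Q Q' : List PlacedSquare} {q : PlacedSquare}
    (h : TouchesHorizontally W Q q) (hQ : Q ⊆ Q') : TouchesHorizontally W Q' q := by
  rcases h with h | h | ⟨q', hq', h⟩ | ⟨q', hq', h⟩
  · exact Or.inl h
  · exact Or.inr (Or.inl h)
  · exact Or.inr (Or.inr (Or.inl ⟨q', hQ hq', h⟩))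
  · exact Or.inr (Or.inr (Or.inr ⟨q', hQ hq', h⟩))

/-- The combinatorial properties of a corner packing. -/
structure IsTouchingPacking (h : ℝ) (Q : List PlacedSquare) : Prop where
  pos : ∀ q ∈ Q, 0 < q.side
  inside : ∀ q ∈ Q, 0 ≤ q.x ∧ q.x + q.side ≤ 1 ∧ 0 ≤ q.y ∧ q.y + q.side ≤ h
  disjoint : Q.Pairwise fun q q' => Disjoint q.inner q'.inner
  horizontal : ∀ q ∈ Q, TouchesHorizontally 1 Q q
  vertical : ∀ q ∈ Q, TouchesHorizontally h (Q.map PlacedSquare.transpose) q.transpose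

theorem IsCornerPacking.isTouchingPacking {h : ℝ} {Q : List PlacedSquare}
    (hQ : IsCornerPacking h Q) : IsTouchingPacking h Q := by
  induction hQ with
  | nil => exact ⟨by simp, by simp, by simp, by simp, by simp⟩
  | @cons q Q _ hpos hfree hcorner ih =>
    obtain ⟨v, hv, hR⟩ := hcorner
    have ht := touches_of_isRightAngleVertex ih.pos hpos hfree hv hR
    have hrect := (openRect_subset_freeSpace_iff ih.pos (by linarith) (by linarith)).1 hfree
    have hsub : Q ⊆ q :: Q := List.subset_cons_self q Q
    refine ⟨?_, ?_, ?_, ?_, ?_⟩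
    · exact List.forall_mem_cons.2 ⟨hpos, ih.pos⟩
    · exact List.forall_mem_cons.2
        ⟨⟨hrect.left, hrect.right, hrect.bottom, hrect.top⟩, ih.inside⟩
    · refine List.pairwise_cons.2 ⟨fun q' hq' => ?_, ih.disjoint⟩
      have := ih.pos q' hq'
      exact (disjoint_openRect_iff (by linarith) (by linarith) (by linarith) (by linarith)).2
        (hrect.avoids q' hq')
    · exact List.forall_mem_cons.2 ⟨ht.1.mono hsub, fun q' hq' => (ih.horizontal q' hq').mono hsub⟩
    · exact List.forall_mem_cons.2 ⟨ht.2.mono (List.map_subset _ hsub),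
        fun q' hq' => (ih.vertical q' hq').mono (List.map_subset _ hsub)⟩

theorem IsTouchingPacking.tightPacking {h D : ℝ} {Q : List PlacedSquare}
    (hQ : IsTouchingPacking h Q) (hD : 0 < D) (hD₁ : 4 * D ≤ 1) (hh : 1 ≤ h) (hlen : Q.length ≤ 4)
    (hside : ∀ q ∈ Q, 4 * D ≤ q.side) : TightPacking 1 h D Q where
  pos := hD
  width := hD₁
  height := hD₁.trans hh
  length := hlen
  side := hside
  left q hq := (hQ.inside q hq).1
  right q hq := (hQ.inside q hq).2.1
  bottom q hq := (hQ.inside q hq).2.2.1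
  top q hq := (hQ.inside q hq).2.2.2
  sep q hq q' hq' hne := by
    have h₁ := hQ.pos q hq
    have h₂ := hQ.pos q' hq'
    have : Std.Symm fun q q' : PlacedSquare => Disjoint q.inner q'.inner := ⟨fun _ _ h => h.symm⟩
    have hd : Disjoint q'.inner q.inner := hQ.disjoint.forall hq' hq hne.symm
    exact (disjoint_openRect_iff (by linarith) (by linarith) (by linarith) (by linarith)).1 hd
  horizontal := hQ.horizontal
  vertical := hQ.vertical

end CornerPacking

/-! ### The blocks dissect the uncovered region -/

section Dissection

variable {h : ℝ} {Q : List PlacedSquare}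

theorem closure_openRect {x₁ x₂ y₁ y₂ : ℝ} (hx : x₁ < x₂) (hy : y₁ < y₂) :
    closure (Ioo x₁ x₂ ×ˢ Ioo y₁ y₂) = Icc x₁ x₂ ×ˢ Icc y₁ y₂ := by
  rw [closure_prod_eq, closure_Ioo hx.ne, closure_Ioo hy.ne]

theorem FreeRect.subset_polygons (hQ : ∀ q ∈ Q, 0 < q.side) {x₁ x₂ y₁ y₂ : ℝ}
    (hf : FreeRect 1 h Q x₁ x₂ y₁ y₂) (hx : x₁ < x₂) (hy : y₁ < y₂) :
    Icc x₁ x₂ ×ˢ Icc y₁ y₂ ⊆ polygons h Q := by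
  rw [← closure_openRect hx hy]
  exact closure_mono ((openRect_subset_freeSpace_iff hQ hx hy).2 hf)

/-- An open square that meets the closure of the free space meets the free space itself, so passing
to the closure creates no room for overlap with a packed square. -/
theorem freeRect_of_subset_polygons (hQ : ∀ q ∈ Q, 0 < q.side) {x₁ x₂ y₁ y₂ : ℝ}
    (hx : x₁ < x₂) (hy : y₁ < y₂) (hsub : Icc x₁ x₂ ×ˢ Icc y₁ y₂ ⊆ polygons h Q) :
    FreeRect 1 h Q x₁ x₂ y₁ y₂ := by
  have hbin : polygons h Q ⊆ Icc 0 1 ×ˢ Icc 0 h :=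
    closure_minimal (fun p hp => prod_mono Ioo_subset_Icc_self Ioo_subset_Icc_self hp.1)
      (isClosed_Icc.prod isClosed_Icc)
  have h₁ := hbin (hsub (mk_mem_prod (left_mem_Icc.2 hx.le) (left_mem_Icc.2 hy.le)))
  have h₂ := hbin (hsub (mk_mem_prod (right_mem_Icc.2 hx.le) (right_mem_Icc.2 hy.le)))
  refine ⟨h₁.1.1, h₂.1.2, h₁.2.1, h₂.2.2, fun q hq => ?_⟩
  have hq₀ := hQ q hq
  refine (disjoint_openRect_iff hx hy (by linarith) (by linarith)).1 ?_
  rw [Set.disjoint_left]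
  intro p hp hpq
  have hpP : p ∈ closure (freeSpace h Q) :=
    hsub (prod_mono Ioo_subset_Icc_self Ioo_subset_Icc_self hp)
  obtain ⟨z, hz, hzf⟩ := mem_closure_iff.1 hpP q.inner (isOpen_Ioo.prod isOpen_Ioo) hpq
  exact hzf.2 (mem_iUnion₂.2 ⟨q, hq, prod_mono Ioo_subset_Icc_self Ioo_subset_Icc_self hz⟩)

theorem isOpen_freeSpace (h : ℝ) (Q : List PlacedSquare) : IsOpen (freeSpace h Q) :=
  (isOpen_Ioo.prod isOpen_Ioo).sdiff
    ((List.finite_toSet Q).isClosed_biUnion fun _ _ => isClosed_Icc.prod isClosed_Icc)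

/-- An uncovered point is the lower left corner of a free square. -/
theorem exists_freeRect_of_mem (hQ : ∀ q ∈ Q, 0 < q.side) {p : ℝ × ℝ} (hp : p ∈ freeSpace h Q) :
    ∃ δ > 0, FreeRect 1 h Q p.1 (p.1 + δ) p.2 (p.2 + δ) := by
  obtain ⟨δ, hδ, hball⟩ := Metric.isOpen_iff.1 (isOpen_freeSpace h Q) p hp
  refine ⟨δ, hδ, (openRect_subset_freeSpace_iff hQ (by linarith) (by linarith)).1 fun z hz => ?_⟩
  refine hball ?_
  rw [Metric.mem_ball, Prod.dist_eq, max_lt_iff, Real.dist_eq, Real.dist_eq, abs_lt, abs_lt]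
  obtain ⟨⟨h₁, h₂⟩, h₃, h₄⟩ := hz
  refine ⟨⟨?_, ?_⟩, ?_, ?_⟩ <;> linarith

theorem exists_isDissection (hQ : ∀ q ∈ Q, 0 < q.side) (hlen : Q.length ≤ 4) {M : ℝ} (hM₀ : 0 ≤ M)
    (hM : SquareBound (FreeRect 1 h Q) M) :
    ∃ m ≤ 10000, ∃ B : Fin m → Block, IsDissection B (polygons h Q) ∧
      ∀ u₁ u₂ v₁ v₂, InGridBlock (FreeRect 1 h Q) (gridLines 1 Q)
        (gridLines h (Q.map PlacedSquare.transpose)) M u₁ u₂ v₁ v₂ →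
          ∃ k, Icc u₁ u₂ ×ˢ Icc v₁ v₂ ⊆ (B k).closed := by
  classical
  set F := FreeRect 1 h Q with hFdef
  set X := gridLines 1 Q with hX
  set Y := gridLines h (Q.map PlacedSquare.transpose) with hY
  have hF : GridRegion F X Y := gridRegion_freeRect fun q hq => (hQ q hq).le
  set S := ((X ×ˢ X) ×ˢ (Y ×ˢ Y)).filter fun z : (ℝ × ℝ) × (ℝ × ℝ) =>
    IsGridBlock F X Y M z.1.1 z.1.2 z.2.1 z.2.2 with hS
  have hXc : X.card ≤ 10 := (card_gridLines_le 1 Q).trans (by omega)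
  have hYc : Y.card ≤ 10 := (card_gridLines_le h _).trans (by rw [List.length_map]; omega)
  have hcard : S.card ≤ 10000 := by
    refine (Finset.card_filter_le _ _).trans ?_
    rw [Finset.card_product, Finset.card_product, Finset.card_product]
    exact Nat.mul_le_mul (Nat.mul_le_mul hXc hXc) (Nat.mul_le_mul hYc hYc)
  set B : Fin S.card → Block := fun k =>
    ⟨(S.equivFin.symm k).1.1.1, (S.equivFin.symm k).1.2.1,
      (S.equivFin.symm k).1.1.2 - (S.equivFin.symm k).1.1.1,
      (S.equivFin.symm k).1.2.2 - (S.equivFin.symm k).1.2.1⟩ with hB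
  have hblock : ∀ k, IsGridBlock F X Y M (S.equivFin.symm k).1.1.1 (S.equivFin.symm k).1.1.2
      (S.equivFin.symm k).1.2.1 (S.equivFin.symm k).1.2.2 := fun k =>
    (Finset.mem_filter.1 (S.equivFin.symm k).2).2
  have hin : ∀ u₁ u₂ v₁ v₂, InGridBlock F X Y M u₁ u₂ v₁ v₂ →
      ∃ k, Icc u₁ u₂ ×ˢ Icc v₁ v₂ ⊆ (B k).closed := by
    rintro u₁ u₂ v₁ v₂ ⟨x₁, x₂, y₁, y₂, hb, h₁, h₂, h₃, h₄⟩
    have hmem : ((x₁, x₂), (y₁, y₂)) ∈ S := by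
      simp only [hS, Finset.mem_filter, Finset.mem_product]
      exact ⟨⟨hb.mem_left, hb.mem_right⟩, hb⟩
    refine ⟨S.equivFin ⟨_, hmem⟩, ?_⟩
    simp only [hB, Block.closed, Equiv.symm_apply_apply, add_sub_cancel]
    exact prod_mono (Icc_subset_Icc h₁ h₂) (Icc_subset_Icc h₃ h₄)
  refine ⟨S.card, hcard, B, ⟨fun k => ?_, fun k l hkl => ?_, ?_⟩, hin⟩
  · exact ⟨sub_pos.2 (hblock k).lt_left, sub_pos.2 (hblock k).lt_right⟩
  · by_contra hnd
    simp only [hB, Block.inner, add_sub_cancel] at hnd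
    rw [disjoint_openRect_iff (hblock k).lt_left (hblock k).lt_right (hblock l).lt_left
      (hblock l).lt_right] at hnd
    simp only [not_or, not_le] at hnd
    obtain ⟨e₁, e₂, e₃, e₄⟩ := (hblock k).eq_of_overlap hF hM hM₀ (hblock l) hnd.2.1 hnd.1
      hnd.2.2.2 hnd.2.2.1
    exact hkl (S.equivFin.symm.injective
      (Subtype.ext (Prod.ext (Prod.ext e₁ e₂) (Prod.ext e₃ e₄))))
  · refine Subset.antisymm (iUnion_subset fun k => ?_) ?_
    · simp only [hB, Block.closed, add_sub_cancel]
      exact (hblock k).free.subset_polygons hQ (hblock k).lt_left (hblock k).lt_right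
    -- A finite union of blocks is closed, so it suffices to cover the points of the open free
    -- space.
    · refine closure_minimal (fun p hp => ?_)
        (isClosed_iUnion_of_finite fun k => isClosed_Icc.prod isClosed_Icc)
      obtain ⟨δ, hδ, hfree⟩ := exists_freeRect_of_mem hQ hp
      obtain ⟨a, a', b, b', ha, hb, -, hap, hpa, hbp, hpb⟩ :=
        hF.exists_cell hfree (by linarith) (by linarith)
      have h₁ : min (p.1 + δ) a' ≤ p.1 + δ := min_le_left _ _
      have h₂ : min (p.1 + δ) a' ≤ a' := min_le_right _ _
      have h₃ : min (p.2 + δ) b' ≤ p.2 + δ := min_le_left _ _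
      have h₄ : min (p.2 + δ) b' ≤ b' := min_le_right _ _
      have h₅ : p.1 < min (p.1 + δ) a' := lt_min (by linarith) hpa
      have h₆ : p.2 < min (p.2 + δ) b' := lt_min (by linarith) hpb
      -- The free square at `p` is trimmed to the grid cell at its corner, so that no grid line
      -- crosses it.
      have hblk : InGridBlock F X Y M p.1 (min (p.1 + δ) a') p.2 (min (p.2 + δ) b') := by
        refine hF.inGridBlock_of_not_crossed (hF.mono hfree le_rfl h₁ le_rfl h₃) h₅ h₆
          (fun x hx => ?_) (fun y hy => ?_)
        · exact (ha.gap x hx).imp (fun e => e.trans hap) fun e => h₂.trans e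
        · exact (hb.gap y hy).imp (fun e => e.trans hbp) fun e => h₄.trans e
      obtain ⟨k, hk⟩ := hin _ _ _ _ hblk
      exact mem_iUnion.2 ⟨k, hk ⟨⟨le_rfl, h₅.le⟩, le_rfl, h₆.le⟩⟩

end Dissection

/-! ### Estimates and the main theorem -/

/-- A long arm in a packing that covers almost the whole bin is narrow. -/
theorem arm_width_le {ε h M σ : ℝ} {k : ℕ} (hε : 0 < ε) (hε₁ : ε ≤ 1 / 4) (hk : 6 ≤ k)
    (hM : M * (ε ^ k / 4) + σ ≤ h) (hσ : h - ε ^ (4 * k - 2) ≤ σ) :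
    3000 * M ≤ ε * (ε ^ k / 4) := by
  -- One factor `ε ^ k` cancels the arm length, `ε ^ k * ε` matches the target, and the rest absorbs
  -- the constants.
  have hpow : ε ^ (4 * k - 2) = ε ^ k * (ε ^ k * ε) * ε ^ (2 * k - 3) := by
    rw [← pow_succ, ← pow_add, ← pow_add]
    congr 1
    omega
  -- The constants to beat are `3000 * 4 * 4 = 48000`; the exponent is at least `9` because `k ≥ 6`.
  have hη : ε ^ (2 * k - 3) ≤ 1 / 262144 := by
    calc ε ^ (2 * k - 3) ≤ ε ^ 9 := pow_le_pow_of_le_one hε.le (by linarith) (by omega)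
      _ ≤ (1 / 4) ^ 9 := pow_le_pow_left₀ hε.le hε₁ 9
      _ = 1 / 262144 := by norm_num
  have hp : 0 < ε ^ k := pow_pos hε k
  have h₁ : ε ^ k * M ≤ ε ^ k * (4 * (ε ^ k * ε) * ε ^ (2 * k - 3)) := by
    rw [hpow] at hσ
    linarith
  have h₂ := le_of_mul_le_mul_left h₁ hp
  have h₃ : 4 * (ε ^ k * ε) * ε ^ (2 * k - 3) ≤ 4 * (ε ^ k * ε) * (1 / 262144) :=
    mul_le_mul_of_nonneg_left hη (by positivity)
  have h₄ : 0 < ε ^ k * ε := by positivity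
  linarith

/-- For a list of squares that are packed in the polygons, most of the profit can be packed in the
blocks. -/
theorem opt_le_opt_of_canRepack {h ε M : ℝ} {Q : List PlacedSquare} {X Y : Finset ℝ} {m : ℕ}
    {B : Fin m → Block} (hQ : ∀ q ∈ Q, 0 < q.side)
    (hB : ∀ u₁ u₂ v₁ v₂, InGridBlock (FreeRect 1 h Q) X Y M u₁ u₂ v₁ v₂ →
      ∃ k, Icc u₁ u₂ ×ˢ Icc v₁ v₂ ⊆ (B k).closed)
    {n : ℕ} (L : Fin n → Item) (hL : ∀ j, 0 < (L j).side ∧ 0 ≤ (L j).profit)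
    (hrepack : ∀ (S : Finset (Fin n)) (u v : Fin n → ℝ),
      (∀ j ∈ S, FreeRect 1 h Q (u j) (u j + (L j).side) (v j) (v j + (L j).side)) →
      (∀ j ∈ S, ∀ l ∈ S, j ≠ l →
        SquaresSeparated (u j) (v j) (L j).side (u l) (v l) (L l).side) →
      CanRepack (FreeRect 1 h Q) X Y M ε S (fun j => (L j).side) fun j => (L j).profit) :
    (1 - ε) * opt L {polygons h Q} ≤ opt L (Set.range fun k => (B k).closed) := by
  obtain ⟨⟨S, ⟨pos, hin, hdis⟩, hS⟩, -⟩ := opt_isGreatest L {polygons h Q}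
  obtain ⟨S', -, u, v, h₁, h₂, h₃⟩ := hrepack S (fun j => (pos j).1) (fun j => (pos j).2)
    (fun j hj => by
      obtain ⟨P, rfl, hP⟩ := hin j hj
      have := (hL j).1
      exact freeRect_of_subset_polygons hQ (by linarith) (by linarith) hP)
    (fun j hj l hl hjl => by
      have := (hL j).1
      have := (hL l).1
      exact (disjoint_openRect_iff (by linarith) (by linarith) (by linarith) (by linarith)).1
        (hdis j hj l hl hjl))
  rw [hS]
  refine h₃.trans ((opt_isGreatest L _).2 ⟨S', ⟨fun j => (u j, v j), fun j hj => ?_,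
    fun j hj l hl hjl => ?_⟩, rfl⟩)
  · obtain ⟨k, hk⟩ := hB _ _ _ _ (h₁ j hj)
    exact ⟨_, ⟨k, rfl⟩, hk⟩
  · have := (hL j).1
    have := (hL l).1
    exact (disjoint_openRect_iff (by linarith) (by linarith) (by linarith) (by linarith)).2
      (h₂ j hj l hl hjl)

theorem mainTheorem5 :
    ∃ N : ℕ, ∀ (h ε : ℝ) (i : ℕ), 1 ≤ h → 0 < ε → ε < 1 / (2 * h + 2 * h ^ 2) → 2 ≤ i →
      ∀ Q : List PlacedSquare, IsCornerPacking h Q → Q.length ≤ 4 →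
        (∀ q ∈ Q, ε ^ 6 ^ (i - 1) ≤ q.side) →
        h - ε ^ (4 * 6 ^ (i - 1) - 2) ≤ (Q.map PlacedSquare.area).sum →
        ∃ m ≤ N, ∃ B : Fin m → Block, IsDissection B (polygons h Q) ∧
          ∀ (n : ℕ) (L : Fin n → Item),
            (∀ j, 0 < (L j).side ∧ (L j).side ≤ ε ^ 6 ^ i ∧ 0 ≤ (L j).profit) →
            (1 - ε) * opt L {polygons h Q} ≤ opt L (Set.range fun k => (B k).closed) := by
  refine ⟨10000, fun h ε i hh hε hεh hi Q hQ hlen hside harea => ?_⟩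
  -- For `h ≥ 1` the denominator `2 * h + 2 * h ^ 2` is at least `4`.
  have hε₁ : ε ≤ 1 / 4 :=
    hεh.le.trans (one_div_le_one_div_of_le (by norm_num) (by nlinarith))
  have hk : 6 ≤ 6 ^ (i - 1) := Nat.le_self_pow (by omega) 6
  set k := 6 ^ (i - 1)
  set D := ε ^ k / 4 with hDdef
  have hεk : 0 < ε ^ k := pow_pos hε k
  have hD : 0 < D := by positivity
  have hεk₁ : ε ^ k ≤ 1 := pow_le_one₀ hε.le (by linarith)
  have htouch := hQ.isTouchingPacking
  have htight : TightPacking 1 h D Q := htouch.tightPacking hD (by linarith) hh hlen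
    fun q hq => by linarith [hside q hq]
  have hdis (M : ℝ) (hM₀ : 0 ≤ M) (hM : SquareBound (FreeRect 1 h Q) M) :=
    exists_isDissection htouch.pos hlen hM₀ hM
  by_cases hfree : ∃ x y t, 0 < t ∧ FreeRect 1 h Q x (x + t) y (y + t)
  · obtain ⟨x, y, t, ht, hfree⟩ := hfree
    obtain ⟨M, hM, harm⟩ := htight.exists_armBound ht hfree
    have hsq := htight.squareBound hM
    have hM₀ : 0 < M := ht.trans_le (hsq x y t ht hfree)
    have hF : GridRegion (FreeRect 1 h Q) (gridLines 1 Q)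
        (gridLines h (Q.map PlacedSquare.transpose)) :=
      gridRegion_freeRect fun q hq => (htouch.pos q hq).le
    have hX : (gridLines 1 Q).card ≤ 10 := (card_gridLines_le 1 Q).trans (by omega)
    have hY : (gridLines h (Q.map PlacedSquare.transpose)).card ≤ 10 :=
      (card_gridLines_le h _).trans (by rw [List.length_map]; omega)
    obtain ⟨m, hm, B, hB, hin⟩ := hdis M hM₀.le hsq
    refine ⟨m, hm, B, hB, fun n L hL => ?_⟩
    refine opt_le_opt_of_canRepack htouch.pos hin L (fun j => ⟨(hL j).1, (hL j).2.2⟩)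
      fun S u v hS hsep => ?_
    rcases harm with ⟨x₀, y₀, harm⟩ | ⟨x₀, y₀, harm⟩
    · have ha := harm.area_le htouch.pos htouch.inside htouch.disjoint (by linarith) (by linarith)
      have hMD : 3000 * M ≤ ε * D := arm_width_le hε hε₁ hk (by simpa using ha) harea
      exact hF.canRepack hsq hM₀ hX hY hε hε₁ hMD harm S u v _ _ (fun j _ => (hL j).1)
        (fun j _ => (hL j).2.2) hS hsep
    · have ha := harm.area_le htouch.pos htouch.inside htouch.disjoint (by linarith) (by linarith)
      have hMD : 3000 * M ≤ ε * D :=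
        arm_width_le hε hε₁ hk (by simpa [mul_comm] using ha) harea
      exact (hF.swap.canRepack hsq.swap hM₀ hY hX hε hε₁ hMD harm S v u _ _
        (fun j _ => (hL j).1) (fun j _ => (hL j).2.2) hS
        fun j hj l hl hjl => (hsep j hj l hl hjl).swap).swap
  -- With no free square at all, `M = 0` is a valid threshold and no item can be packed.
  · obtain ⟨m, hm, B, hB, hin⟩ := hdis 0 le_rfl fun x y t ht hf => (hfree ⟨x, y, t, ht, hf⟩).elim
    refine ⟨m, hm, B, hB, fun n L hL => ?_⟩
    refine opt_le_opt_of_canRepack htouch.pos hin L (fun j => ⟨(hL j).1, (hL j).2.2⟩)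
      fun S u v hS hsep => ?_
    obtain rfl : S = ∅ := Finset.eq_empty_of_forall_notMem fun j hj =>
      hfree ⟨_, _, _, (hL j).1, hS j hj⟩
    exact ⟨∅, le_rfl, u, v, by simp, by simp, by simp⟩
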